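/- Let $N\in\mathbb N$ be odd, $S=\{-1,+1\}^N$, let $\mu$ be the uniform distribution on $S$, and let $$H(\sigma)=-\frac1{2N}\sum_{i,j=1}^N\sigma_i\sigma_j,\qquad \mu_t(\sigma)=\frac{e^{-tH(\sigma)}\mu(\sigma)}{\sum_{\tau\in S}e^{-tH(\tau)}\mu(\tau)}\qquad(\sigma\in S,\ t\ge 0)$$ (the mean field Ising, or Curie–Weiss, model). Let $\mathcal L_t$ be the generator of the continuous-time Metropolis chain with respect to $\mu_t$ based on the nearest neighbour random walk on $S$: $\mathcal L_t(\sigma,\tau)=\frac1N\min\big(\mu_t(\tau)/\mu_t(\sigma),1\big)$ if $\sigma,\tau$ differ in exactly one coordinate, $\mathcal L_t(\sigma,\tau)=0$ if they differ in at least two coordinates, and $\mathcal L_t(\sigma,\sigma)=-\sum_{\tau\ne\sigma}\mathcal L_t(\sigma,\tau)$. Let $t\mapsto M_t\ge 0$ be a continuous function on $[0,\infty)$, and let $p_{s,t}$ $(0\le s\le t)$ be the unique solution of the forward equation $$\frac{\partial}{\partial t}p_{s,t}f=p_{s,t}(M_t\mathcal L_tf-Hf),\qquad p_{s,s}f=f\qquad(f:S\to\mathbb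 R).$$ For a probability measure $\nu$ on $S$ put $$\nu_t=\Phi_{0,t}\nu:=\frac{\nu p_{0,t}}{(\nu p_{0,t})(S)},\qquad \varepsilon_t:=\sum_{\sigma\in S}\Big(\frac{\nu_t(\sigma)}{\mu_t(\sigma)}-1\Big)^2\mu_t(\sigma).$$ Theorem. Let $\beta>0$ and let $\nu$ be any probability measure on $S$. If $\varepsilon_0\le 1$ and $$M_t\ \ge\ \frac94N^3+\frac98\,\beta N^4\qquad\text{for all }t\in(0,\beta),$$ then $$\sup_{0\le t\le\beta}\varepsilon_t\ \le\ e^2\,\varepsilon_0 .$$ -/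

import Mathlib

open scoped Matrix

section LinearODE

/-! Existence and uniqueness for the linear equation `P' = P A`, used to make sure that the
forward equation below has exactly one solution. -/

/-- Terms of the Dyson series. -/
noncomputable def dysonTerm {R : Type*} [NormedRing R] [NormedAlgebra ℝ R]
    (A : ℝ → R) (s : ℝ) : ℕ → ℝ → R
  | 0 => fun _ => 1
  | n + 1 => fun t => ∫ u in s..t, dysonTerm A s n u * A u

theorem dysonTerm_continuous {R : Type*} [NormedRing R] [NormedAlgebra ℝ R] [CompleteSpace R]
    {A : ℝ → R} (hA : Continuous A) (s : ℝ) (n : ℕ) : Continuous (dysonTerm A s n) := by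
  induction n with
  | zero => exact continuous_const
  | succ n ih =>
    exact intervalIntegral.continuous_primitive
      (fun a b => (ih.mul hA).intervalIntegrable a b) s

theorem dysonTerm_hasDerivAt {R : Type*} [NormedRing R] [NormedAlgebra ℝ R] [CompleteSpace R]
    {A : ℝ → R} (hA : Continuous A) (s : ℝ) (n : ℕ) (t : ℝ) :
    HasDerivAt (dysonTerm A s (n + 1)) (dysonTerm A s n t * A t) t := by
  have hc : Continuous (fun u => dysonTerm A s n u * A u) :=
    (dysonTerm_continuous hA s n).mul hA
  exact intervalIntegral.integral_hasDerivAt_right (hc.intervalIntegrable s t)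
    (hc.stronglyMeasurableAtFilter _ _) hc.continuousAt

theorem norm_dysonTerm_le {R : Type*} [NormedRing R] [NormedAlgebra ℝ R] [CompleteSpace R]
    {A : ℝ → R} (hA : Continuous A) {s T K : ℝ}
    (hK : ∀ u ∈ Metric.ball s T, ‖A u‖ ≤ K) (n : ℕ) :
    ∀ t ∈ Metric.ball s T, ‖dysonTerm A s n t‖ ≤
      ‖(1 : R)‖ * (K ^ n * |t - s| ^ n / (n.factorial : ℝ)) := by
  induction n with
  | zero => intro t _; simp [dysonTerm]
  | succ n ih =>
    intro t ht
    have hsub : ∀ u ∈ Set.uIoc s t, u ∈ Metric.ball s T := by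
      intro u hu
      have h1 : |u - s| ≤ |t - s| :=
        Set.abs_sub_left_of_mem_uIcc (Set.uIoc_subset_uIcc hu)
      rw [Metric.mem_ball, Real.dist_eq] at ht ⊢
      exact lt_of_le_of_lt h1 ht
    have hint : MeasureTheory.IntegrableOn
        (fun u => ‖(1 : R)‖ * K ^ (n + 1) / (n.factorial : ℝ) * |u - s| ^ n)
        (Set.uIoc s t) MeasureTheory.volume := by
      rw [← intervalIntegrable_iff]
      exact Continuous.intervalIntegrable (by fun_prop) _ _
    calc ‖dysonTerm A s (n + 1) t‖
        ≤ ∫ u in Set.uIoc s t, ‖dysonTerm A s n u * A u‖ :=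
          intervalIntegral.norm_integral_le_integral_norm_uIoc
      _ ≤ ∫ u in Set.uIoc s t,
            ‖(1 : R)‖ * K ^ (n + 1) / (n.factorial : ℝ) * |u - s| ^ n := by
          refine MeasureTheory.setIntegral_mono_on ?_ hint measurableSet_uIoc ?_
          · rw [← intervalIntegrable_iff]
            exact (((dysonTerm_continuous hA s n).mul hA).norm).intervalIntegrable _ _
          · intro u hu
            have hu' := hsub u hu
            have h1 := ih u hu'
            calc ‖dysonTerm A s n u * A u‖ ≤ ‖dysonTerm A s n u‖ * ‖A u‖ := norm_mul_le _ _
              _ ≤ (‖(1 : R)‖ * (K ^ n * |u - s| ^ n / (n.factorial : ℝ))) * K :=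
                  mul_le_mul h1 (hK u hu') (norm_nonneg _) ((norm_nonneg _).trans h1)
              _ = ‖(1 : R)‖ * K ^ (n + 1) / (n.factorial : ℝ) * |u - s| ^ n := by ring
      _ = ‖(1 : R)‖ * (K ^ (n + 1) * |t - s| ^ (n + 1) / ((n + 1).factorial : ℝ)) := by
          rw [MeasureTheory.integral_const_mul, integral_pow_abs_sub_uIoc, Nat.factorial_succ]
          push_cast
          field_simp

theorem exists_linear_ode {R : Type*} [NormedRing R] [NormedAlgebra ℝ R] [CompleteSpace R]
    {A : ℝ → R} (hA : Continuous A) (s : ℝ) :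
    ∃ P : ℝ → R, P s = 1 ∧ ∀ t, HasDerivAt P (P t * A t) t := by
  have hbd : ∀ T : ℝ, ∃ K : ℝ, 0 ≤ K ∧ ∀ u ∈ Metric.ball s T, ‖A u‖ ≤ K := by
    intro T
    obtain ⟨K, hK⟩ := (isCompact_closedBall s T).exists_bound_of_continuousOn hA.continuousOn
    exact ⟨max K 0, le_max_right _ _, fun u hu =>
      (hK u (Metric.ball_subset_closedBall hu)).trans (le_max_left _ _)⟩
  have hbd2 : ∀ T : ℝ, ∃ v : ℕ → ℝ, Summable v ∧
      ∀ n, ∀ t ∈ Metric.ball s T, ‖dysonTerm A s n t‖ ≤ v n := by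
    intro T
    obtain ⟨K, hK0, hK⟩ := hbd T
    refine ⟨fun n => ‖(1 : R)‖ * ((K * T) ^ n / (n.factorial : ℝ)),
      (Real.summable_pow_div_factorial (K * T)).mul_left _, fun n t ht => ?_⟩
    refine (norm_dysonTerm_le hA hK n t ht).trans ?_
    rw [Metric.mem_ball, Real.dist_eq] at ht
    simp only [mul_pow]
    gcongr
  have hs0 : ∀ n, dysonTerm A s (n + 1) s = 0 := by
    intro n; simp [dysonTerm]
  refine ⟨fun t => ∑' n, dysonTerm A s n t, ?_, ?_⟩
  · change ∑' n, dysonTerm A s n s = 1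
    rw [tsum_eq_single 0]
    · simp [dysonTerm]
    · intro n hn
      obtain ⟨m, rfl⟩ := Nat.exists_eq_succ_of_ne_zero hn
      exact hs0 m
  · intro t
    set T := |t - s| + 1 with hT
    have htT : t ∈ Metric.ball s T := by
      rw [Metric.mem_ball, Real.dist_eq]; linarith
    have hsT : s ∈ Metric.ball s T := Metric.mem_ball_self (by positivity)
    obtain ⟨v, hv, hvb⟩ := hbd2 T
    obtain ⟨K, hK0, hK⟩ := hbd T
    have hsum : ∀ x ∈ Metric.ball s T, Summable (fun n => dysonTerm A s n x) := fun x hx =>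
      Summable.of_norm_bounded hv (fun n => hvb n x hx)
    have key : HasDerivAt (fun t => ∑' n, dysonTerm A s (n + 1) t)
        (∑' n, dysonTerm A s n t * A t) t := by
      refine hasDerivAt_tsum_of_isPreconnected (u := fun n => v n * K) (hv.mul_right K)
        Metric.isOpen_ball (convex_ball s T).isPreconnected
        (fun n y _ => dysonTerm_hasDerivAt hA s n y) (fun n y hy => ?_) hsT ?_ htT
      · exact (norm_mul_le _ _).trans (mul_le_mul (hvb n y hy) (hK y hy) (norm_nonneg _)
          ((norm_nonneg _).trans (hvb n y hy)))
      · simp only [hs0]; exact summable_zero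
    have heq : (fun t => ∑' n, dysonTerm A s n t) =ᶠ[nhds t]
        fun t => 1 + ∑' n, dysonTerm A s (n + 1) t := by
      filter_upwards [Metric.isOpen_ball.mem_nhds htT] with x hx
      rw [(hsum x hx).tsum_eq_zero_add]
      simp [dysonTerm]
    have h2 : ∑' n, dysonTerm A s n t * A t = (∑' n, dysonTerm A s n t) * A t :=
      (hsum t htT).tsum_mul_right (A t)
    rw [← h2]
    exact (key.const_add 1).congr_of_eventuallyEq heq

theorem unique_linear_ode {R : Type*} [NormedRing R] [NormedAlgebra ℝ R]
    {A : ℝ → R} (hA : Continuous A) {s : ℝ} {P Q : ℝ → R} (h0 : P s = Q s)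
    (hP : ∀ t, s ≤ t → HasDerivWithinAt P (P t * A t) (Set.Ici s) t)
    (hQ : ∀ t, s ≤ t → HasDerivWithinAt Q (Q t * A t) (Set.Ici s) t)
    {t : ℝ} (ht : s ≤ t) : P t = Q t := by
  obtain ⟨K, hK⟩ := (isCompact_Icc (a := s) (b := t)).exists_bound_of_continuousOn hA.continuousOn
  have hd : ∀ x, s ≤ x → HasDerivWithinAt (P - Q) ((P - Q) x * A x) (Set.Ici s) x := by
    intro x hx
    have := (hP x hx).sub (hQ x hx)
    rwa [← sub_mul] at this
  have := eq_zero_of_abs_deriv_le_mul_abs_self_of_eq_zero_right (f := P - Q)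
    (f' := fun x => (P - Q) x * A x) (K := K) (a := s) (b := t)
    (fun x hx => (hd x hx.1).continuousWithinAt.mono Set.Icc_subset_Ici_self)
    (fun x hx => (hd x hx.1).mono (Set.Ici_subset_Ici.2 hx.1))
    (by simp [h0])
    (fun x hx => by
      rw [mul_comm K]
      exact (norm_mul_le _ _).trans
        (mul_le_mul_of_nonneg_left (hK x ⟨hx.1, hx.2.le⟩) (norm_nonneg _)))
    t ⟨ht, le_rfl⟩
  exact sub_eq_zero.1 this

end LinearODE

section FeynmanKac

/-- The expectation `ν(f) = ∑ x, f x ν(x)`. -/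
def expect {S : Type*} [Fintype S] (ν f : S → ℝ) : ℝ := ∑ x, f x * ν x

/-- `μ_t(x) = Z_t⁻¹ e^{-t H(x)} μ(x)`. -/
noncomputable def gibbs {S : Type*} [Fintype S] (μ H : S → ℝ) (t : ℝ) (x : S) : ℝ :=
  Real.exp (-t * H x) * μ x / ∑ y, Real.exp (-t * H y) * μ y

/-- The generator (`Q`-matrix) of the continuous-time Metropolis chain with respect to `π`, with
proposal matrix `K`. -/
noncomputable def metropolis {S : Type*} [Fintype S] [DecidableEq S]
    (K : Matrix S S ℝ) (π : S → ℝ) : Matrix S S ℝ :=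
  fun x y => if x = y then -∑ z ∈ Finset.univ.erase x, K x z * min (π z / π x) 1
    else K x y * min (π y / π x) 1

/-- `p_{s,·}` solves the forward equation `∂ₜ p_{s,t} = p_{s,t} A_t` for `t ≥ s`,
with `p_{s,s} = 1` (at `t = s` the derivative is one-sided). -/
def IsForwardSolution {S : Type*} [Fintype S] [DecidableEq S]
    (A : ℝ → Matrix S S ℝ) (s : ℝ) (p : ℝ → Matrix S S ℝ) : Prop :=
  p s = 1 ∧ ∀ t, s ≤ t → ∀ x y,
    HasDerivWithinAt (fun u => p u x y) ((p t * A t) x y) (Set.Ici s) t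

theorem exists_isForwardSolution {S : Type*} [Fintype S] [DecidableEq S]
    {A : ℝ → Matrix S S ℝ} {s : ℝ} (hA : ContinuousOn A (Set.Ici s)) :
    ∃ p, IsForwardSolution A s p := by
  let _ : NormedRing (Matrix S S ℝ) := Matrix.linftyOpNormedRing
  let _ : NormedAlgebra ℝ (Matrix S S ℝ) := Matrix.linftyOpNormedAlgebra
  have hA' : Continuous (fun t => A (max t s)) :=
    hA.comp_continuous (by fun_prop) (fun t => le_max_right t s)
  obtain ⟨P, h0, hP⟩ := exists_linear_ode hA' s
  refine ⟨P, h0, fun t ht x y => ?_⟩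
  have h1 := hP t
  simp only [max_eq_left ht] at h1
  exact (hasDerivAt_pi.1 (hasDerivAt_pi.1 h1 x) y).hasDerivWithinAt

theorem isForwardSolution_unique {S : Type*} [Fintype S] [DecidableEq S]
    {A : ℝ → Matrix S S ℝ} {s : ℝ} (hA : ContinuousOn A (Set.Ici s))
    {p q : ℝ → Matrix S S ℝ} (hp : IsForwardSolution A s p) (hq : IsForwardSolution A s q)
    {t : ℝ} (ht : s ≤ t) : p t = q t := by
  let _ : NormedRing (Matrix S S ℝ) := Matrix.linftyOpNormedRing
  let _ : NormedAlgebra ℝ (Matrix S S ℝ) := Matrix.linftyOpNormedAlgebra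
  have hA' : Continuous (fun t => A (max t s)) :=
    hA.comp_continuous (by fun_prop) (fun t => le_max_right t s)
  have hd : ∀ {r : ℝ → Matrix S S ℝ}, IsForwardSolution A s r → ∀ t, s ≤ t →
      HasDerivWithinAt r (r t * A (max t s)) (Set.Ici s) t := by
    intro r hr t ht
    rw [max_eq_left ht]
    exact hasDerivWithinAt_pi.2 fun x => hasDerivWithinAt_pi.2 fun y => hr.2 t ht x y
  exact unique_linear_ode hA' (hp.1.trans hq.1.symm) (hd hp) (hd hq) ht

open Classical in
/-- The solution `p_{s,t}` of the forward equation; by `exists_isForwardSolution` and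
`isForwardSolution_unique` it exists and is unique whenever `A` is continuous on `[s, ∞)`. -/
noncomputable def propagator {S : Type*} [Fintype S] [DecidableEq S]
    (A : ℝ → Matrix S S ℝ) (s : ℝ) : ℝ → Matrix S S ℝ :=
  if h : ∃ p, IsForwardSolution A s p then h.choose else 1

theorem propagator_spec {S : Type*} [Fintype S] [DecidableEq S]
    {A : ℝ → Matrix S S ℝ} {s : ℝ} (hA : ContinuousOn A (Set.Ici s)) :
    IsForwardSolution A s (propagator A s) := by
  have h := exists_isForwardSolution hA
  rw [propagator, dif_pos h]
  exact h.choose_spec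

/-- The matrix `M_t L_t - H` of the operator `f ↦ M_t L_t f - H f`. -/
def killedGenerator {S : Type*} [DecidableEq S]
    (M : ℝ → ℝ) (L : ℝ → Matrix S S ℝ) (H : S → ℝ) (t : ℝ) : Matrix S S ℝ :=
  M t • L t - Matrix.diagonal H

/-- The nonlinear semigroup `Φ_{s,t} ν = ν p_{s,t} / (ν p_{s,t})(S)`. -/
noncomputable def nonlinearFlow {S : Type*} [Fintype S] [DecidableEq S]
    (M : ℝ → ℝ) (L : ℝ → Matrix S S ℝ) (H : S → ℝ) (s t : ℝ) (ν : S → ℝ) : S → ℝ :=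
  (∑ z, (ν ᵥ* propagator (killedGenerator M L H) s t) z)⁻¹ •
    (ν ᵥ* propagator (killedGenerator M L H) s t)

/-- The mean square error (`χ²`-contrast) `E_μ[(g - 1)²]`, `g = ν / μ`, of `ν` with respect
to `μ`. -/
noncomputable def meanSquareError {S : Type*} [Fintype S] (ν μ : S → ℝ) : ℝ :=
  expect μ (fun x => (ν x / μ x - 1) ^ 2)

end FeynmanKac

section CurieWeiss

/-- The hypercube `{-1, +1}^N` (`ℤˣ` consists of `1` and `-1`). -/
abbrev Hypercube (N : ℕ) : Type := Fin N → ℤˣ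

/-- The uniform distribution on the hypercube. -/
noncomputable def uniformHypercube (N : ℕ) (_σ : Hypercube N) : ℝ := 1 / 2 ^ N

/-- The Curie–Weiss energy `H(σ) = -(1 / 2N) ∑_{i,j} σ_i σ_j`. -/
noncomputable def curieWeissEnergy (N : ℕ) (σ : Hypercube N) : ℝ :=
  -(1 / (2 * (N : ℝ))) * ∑ i, ∑ j, ((σ i : ℤ) : ℝ) * ((σ j : ℤ) : ℝ)

/-- Transition matrix of the nearest neighbour random walk on the hypercube. -/
noncomputable def nearestNeighborWalk (N : ℕ) : Matrix (Hypercube N) (Hypercube N) ℝ :=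
  fun σ τ => if hammingDist σ τ = 1 then 1 / (N : ℝ) else 0

/-- The Curie–Weiss measure `μ_t` at inverse temperature `t`. -/
noncomputable def curieWeissMeasure (N : ℕ) (t : ℝ) : Hypercube N → ℝ :=
  gibbs (uniformHypercube N) (curieWeissEnergy N) t

/-- The generator `L_t` of the Metropolis dynamics for the Curie–Weiss measure `μ_t`. -/
noncomputable def curieWeissMetropolis (N : ℕ) (t : ℝ) :
    Matrix (Hypercube N) (Hypercube N) ℝ :=
  metropolis (nearestNeighborWalk N) (curieWeissMeasure N t)

/-- For the Curie–Weiss model the forward equation is well posed: its coefficient matrix is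
continuous in time. -/
theorem curieWeiss_killedGenerator_continuousOn (N : ℕ) (M : ℝ → ℝ) (hM : ContinuousOn M (Set.Ici 0)) :
    ContinuousOn (killedGenerator M (curieWeissMetropolis N) (curieWeissEnergy N)) (Set.Ici 0) := by
  have hg : ∀ σ, Continuous (fun t => curieWeissMeasure N t σ) := by
    intro σ
    unfold curieWeissMeasure gibbs
    refine Continuous.div (by fun_prop) (by fun_prop) fun t => ?_
    refine (Finset.sum_pos (fun y _ => ?_) Finset.univ_nonempty).ne'
    unfold uniformHypercube; positivity
  have hp : ∀ σ t, curieWeissMeasure N t σ ≠ 0 := by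
    intro σ t
    unfold curieWeissMeasure gibbs
    refine (div_pos ?_ (Finset.sum_pos (fun y _ => ?_) Finset.univ_nonempty)).ne' <;>
    · unfold uniformHypercube; positivity
  have hL : Continuous (curieWeissMetropolis N) := by
    refine continuous_matrix fun x y => ?_
    have h := fun a b => (hg b).div (hg a) (hp a)
    unfold curieWeissMetropolis metropolis
    split_ifs
    · refine (continuous_finsetSum _ fun z _ => ?_).neg
      exact continuous_const.mul ((h x z).min continuous_const)
    · exact continuous_const.mul ((h x y).min continuous_const)
  exact (hM.smul hL.continuousOn).sub continuousOn_const

/-- `ε_t`, the mean square error of `ν_t = Φ_{0,t} ν` with respect to `μ_t`. -/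
noncomputable def curieWeissError (N : ℕ) (M : ℝ → ℝ) (ν : Hypercube N → ℝ) (t : ℝ) : ℝ :=
  meanSquareError
    (nonlinearFlow M (curieWeissMetropolis N) (curieWeissEnergy N) 0 t ν)
    (curieWeissMeasure N t)

end CurieWeiss

/-!
With `h = ν_t / μ_t - 1`, `H' = H - μ_t(H)` and the error `ε = μ_t(h ^ 2)`, the forward equation
gives `ε' = -2 M_t E_t(h) + 2 ε μ_t(h H') - μ_t(h ^ 2 H')`, where `E_t` is the Dirichlet form of
`L_t` (`hasDerivWithinAt_meanSquareError`). At low temperature the chain is slow to cross between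
the two halves of the hypercube on which the magnetization is positive or negative, so `E_t` does
not control `ε` with a polynomial constant. But the energy is even under `σ ↦ -σ`, hence
uncorrelated with the sign `s` of the magnetization: writing `h = a s + k` with `k` centred on each
half, every term in which `h` is multiplied by `H'` contains a factor `k` (`error_growth_le`), and
`k` is controlled by a Poincaré inequality local to the halves.

The local Poincaré inequality `Hypercube.exists_poincare_half` is proved by splitting the half
with positive magnetization into levels of constant number of negative spins.
* Inside a level, the operators `U` and `D` that sum over the lower and upper neighbours satisfy
  `D U - U D = ∑ i, σ i`, which bounds the spectrum of `U D` (`Hypercube.sum_downSum_sq_le`).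
* Across the levels, the weights are unimodal (`Hypercube.exists_mode`) because `artanh x / x` is
  monotone, and a discrete Hardy inequality (`sum_unimodal_sub_sq_le`) applies.

The resulting constant is `N ^ 2 * (1 + t)`. Its growth in `t` is harmless: Jensen's inequality
gives `μ_t(H) + N / 2 ≤ N * log 2 / t`, and with it the variance of `H` and the upper bound of `-H'`
decay like `1 / t` (`Hypercube.poincare_const_mul_le`). The lower bound on `M_t` therefore implies
`ε' ≤ ε / β + ε ^ 2 / (e β)`. Solving this logistic inequality up to time `β` from `ε 0 ≤ 1` gives
the factor `e ^ 2` (`le_exp_two_mul_of_logistic`).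
-/

open scoped Matrix

/-! ### Flips of spins and the edges of the hypercube -/

namespace Hypercube

variable {N : ℕ}

/-- The configuration `σ` with the `i`-th spin reversed. -/
def flip (i : Fin N) (σ : Hypercube N) : Hypercube N := Function.update σ i (-σ i)

@[simp] theorem flip_apply_self (i : Fin N) (σ : Hypercube N) : flip i σ i = -σ i := by
  simp [flip]

theorem flip_apply_of_ne {i j : Fin N} (h : j ≠ i) (σ : Hypercube N) : flip i σ j = σ j := by
  simp [flip, h]

@[simp] theorem flip_flip (i : Fin N) (σ : Hypercube N) : flip i (flip i σ) = σ := by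
  simp [flip]

theorem flip_comm (i j : Fin N) (σ : Hypercube N) : flip i (flip j σ) = flip j (flip i σ) := by
  by_cases h : i = j
  · rw [h]
  · ext l
    by_cases hi : l = i
    · subst hi; simp [flip_apply_of_ne h]
    · by_cases hj : l = j
      · subst hj; simp [flip_apply_of_ne hi]
      · simp [flip_apply_of_ne hi, flip_apply_of_ne hj]

theorem flip_involutive (i : Fin N) : Function.Involutive (flip i : Hypercube N → Hypercube N) :=
  flip_flip i

theorem sum_comp_flip (i : Fin N) (f : Hypercube N → ℝ) : ∑ σ, f (flip i σ) = ∑ σ, f σ :=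
  Equiv.sum_comp (flip_involutive i).toPerm f

theorem sum_comp_neg (f : Hypercube N → ℝ) : ∑ σ, f (-σ) = ∑ σ, f σ :=
  Equiv.sum_comp (Equiv.neg (Hypercube N)) f

theorem neg_flip (i : Fin N) (σ : Hypercube N) : flip i (-σ) = -flip i σ := by
  ext j
  by_cases h : j = i
  · subst h; simp
  · simp [flip_apply_of_ne h]

theorem spin_ne_one_iff (u : ℤˣ) : u ≠ 1 ↔ u = -1 := by
  rcases Int.units_eq_one_or u with h | h <;> subst h <;> decide

theorem spin_neg_eq_neg_one_iff (u : ℤˣ) : -u = -1 ↔ u = 1 := by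
  rcases Int.units_eq_one_or u with h | h <;> subst h <;> decide

/-- The number of negative spins of a configuration. -/
def minusCount (σ : Hypercube N) : ℕ := ∑ i, if σ i = -1 then 1 else 0

theorem minusCount_cast (σ : Hypercube N) :
    (minusCount σ : ℝ) = ∑ i, if σ i = -1 then (1 : ℝ) else 0 := by
  simp [minusCount]

theorem minusCount_le (σ : Hypercube N) : minusCount σ ≤ N := by
  unfold minusCount
  calc _ ≤ ∑ i : Fin N, 1 := Finset.sum_le_sum fun i _ => by split_ifs <;> simp
    _ = N := by simp

theorem plusCount_cast (σ : Hypercube N) :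
    ∑ i, (if σ i = 1 then (1 : ℝ) else 0) = N - minusCount σ := by
  rw [minusCount_cast, eq_sub_iff_add_eq, ← Finset.sum_add_distrib]
  calc _ = ∑ i : Fin N, (1 : ℝ) := Finset.sum_congr rfl fun i _ => by
        rcases Int.units_eq_one_or (σ i) with h | h <;> rw [h] <;> simp
    _ = N := by simp

theorem sum_spin (σ : Hypercube N) : ∑ i, ((σ i : ℤ) : ℝ) = N - 2 * minusCount σ := by
  have h : ∀ i, ((σ i : ℤ) : ℝ) =
      (if σ i = 1 then (1 : ℝ) else 0) - if σ i = -1 then (1 : ℝ) else 0 := by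
    intro i
    rcases Int.units_eq_one_or (σ i) with h | h <;> rw [h] <;> simp
  simp_rw [h]
  rw [Finset.sum_sub_distrib, plusCount_cast, ← minusCount_cast]
  ring

theorem minusCount_neg (σ : Hypercube N) : minusCount (-σ) = N - minusCount σ := by
  have h := plusCount_cast σ
  have h2 : (minusCount (-σ) : ℝ) = N - minusCount σ := by
    rw [← h, minusCount_cast]
    exact Finset.sum_congr rfl fun i _ => by simp only [Pi.neg_apply, spin_neg_eq_neg_one_iff]
  have h3 : minusCount (-σ) + minusCount σ = N := by
    have : (minusCount (-σ) : ℝ) + minusCount σ = N := by rw [h2]; ring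
    exact_mod_cast this
  omega

theorem minusCount_flip_of_eq_neg_one {i : Fin N} {σ : Hypercube N} (h : σ i = -1) :
    minusCount (flip i σ) + 1 = minusCount σ := by
  unfold minusCount
  rw [← Finset.add_sum_erase _ _ (Finset.mem_univ i),
    ← Finset.add_sum_erase (a := i) _ (fun j => if σ j = -1 then 1 else 0) (Finset.mem_univ i)]
  rw [Finset.sum_congr rfl (g := fun j => if σ j = -1 then 1 else 0) fun j hj => by
    rw [flip_apply_of_ne (Finset.ne_of_mem_erase hj)]]
  simp [h]
  ring

theorem minusCount_flip_of_eq_one {i : Fin N} {σ : Hypercube N} (h : σ i = 1) :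
    minusCount (flip i σ) = minusCount σ + 1 := by
  have := minusCount_flip_of_eq_neg_one (i := i) (σ := flip i σ) (by simp [h])
  rw [flip_flip] at this
  exact this.symm

theorem minusCount_eq_zero_iff (σ : Hypercube N) : minusCount σ = 0 ↔ σ = 1 := by
  unfold minusCount
  simp only [Finset.sum_eq_zero_iff, Finset.mem_univ, true_imp_iff]
  constructor
  · intro h
    funext i
    have := h i
    by_contra h1
    simp [(spin_ne_one_iff _).1 h1] at this
  · rintro rfl i
    simp

/-- Each edge of the hypercube has one end with a negative and one with a positive spin at the
coordinate that is flipped; a sum over edges may be indexed by either end. -/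
theorem sum_edges_comm (F : Hypercube N → Hypercube N → ℝ) :
    ∑ σ, ∑ i, (if σ i = -1 then F σ (flip i σ) else 0) =
      ∑ σ, ∑ i, if σ i = 1 then F (flip i σ) σ else 0 := by
  rw [Finset.sum_comm, Finset.sum_comm (f := fun σ i => if σ i = 1 then F (flip i σ) σ else 0)]
  refine Finset.sum_congr rfl fun i _ => ?_
  rw [← sum_comp_flip i]
  refine Finset.sum_congr rfl fun σ _ => ?_
  simp only [flip_apply_self, flip_flip, spin_neg_eq_neg_one_iff]

/-- `(U f)(σ)`: the sum of `f` over the neighbours of `σ` with one negative spin less. -/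
def upSum (f : Hypercube N → ℝ) (σ : Hypercube N) : ℝ :=
  ∑ i, if σ i = -1 then f (flip i σ) else 0

/-- `(D f)(σ)`: the sum of `f` over the neighbours of `σ` with one negative spin more. -/
def downSum (f : Hypercube N → ℝ) (σ : Hypercube N) : ℝ :=
  ∑ i, if σ i = 1 then f (flip i σ) else 0

theorem sum_mul_upSum (f g : Hypercube N → ℝ) :
    ∑ σ, g σ * upSum f σ = ∑ σ, downSum g σ * f σ := by
  have := sum_edges_comm (fun σ τ => g σ * f τ)
  simp only [upSum, downSum, Finset.mul_sum, Finset.sum_mul, mul_ite, ite_mul, mul_zero, zero_mul]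
  exact this

theorem sum_downSum (f : Hypercube N → ℝ) :
    ∑ σ, downSum f σ = ∑ σ, minusCount σ * f σ := by
  have := sum_edges_comm (fun σ _ => f σ)
  simp only [minusCount_cast, Finset.sum_mul, ite_mul, one_mul, zero_mul]
  exact this.symm

end Hypercube

/-! ### The raising and lowering operators -/

namespace Hypercube

variable {N : ℕ}

/-- The commutation relation `D U - U D = ∑ i, σ i` of the two operators. -/
theorem downSum_upSum (f : Hypercube N → ℝ) (σ : Hypercube N) :
    downSum (upSum f) σ = upSum (downSum f) σ + (N - 2 * minusCount σ) * f σ := by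
  have key : ∀ i j, (if σ i = 1 then
        (if flip i σ j = -1 then f (flip j (flip i σ)) else 0) else 0) =
      (if σ j = -1 then (if flip j σ i = 1 then f (flip i (flip j σ)) else 0) else 0) +
        if i = j then ((σ i : ℤ) : ℝ) * f σ else 0 := by
    intro i j
    by_cases h : i = j
    · subst h
      rcases Int.units_eq_one_or (σ i) with h | h <;> simp [h]
    · rw [flip_apply_of_ne h, flip_apply_of_ne (Ne.symm h), flip_comm i j, if_neg h, add_zero]
      split_ifs <;> rfl
  rw [← sum_spin, Finset.sum_mul]
  simp only [downSum, upSum, Finset.ite_sum_zero]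
  rw [Finset.sum_comm (f := fun j i => if σ j = -1 then
    (if flip j σ i = 1 then f (flip i (flip j σ)) else 0) else 0), ← Finset.sum_add_distrib]
  refine Finset.sum_congr rfl fun i _ => ?_
  simp_rw [key i, Finset.sum_add_distrib]
  simp

theorem sum_upSum_sq (f : Hypercube N → ℝ) :
    ∑ σ, upSum f σ ^ 2 = ∑ σ, downSum f σ ^ 2 + ∑ σ, (N - 2 * minusCount σ) * f σ ^ 2 := by
  have h1 : ∑ σ, upSum f σ ^ 2 = ∑ σ, downSum (upSum f) σ * f σ := by
    rw [← sum_mul_upSum]; simp only [sq]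
  have h2 : ∑ σ, downSum f σ ^ 2 = ∑ σ, upSum (downSum f) σ * f σ := by
    simp only [sq]
    rw [← sum_mul_upSum]
    exact Finset.sum_congr rfl fun σ _ => mul_comm _ _
  rw [h1, h2, ← Finset.sum_add_distrib]
  refine Finset.sum_congr rfl fun σ _ => ?_
  rw [downSum_upSum]; ring

theorem downSum_eq_zero_of_support {f : Hypercube N → ℝ} {k : ℕ}
    (hf : ∀ σ, minusCount σ ≠ k + 1 → f σ = 0) (σ : Hypercube N) (hσ : minusCount σ ≠ k) :
    downSum f σ = 0 := by
  refine Finset.sum_eq_zero fun i _ => ?_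
  split_ifs with h
  · exact hf _ (by rw [minusCount_flip_of_eq_one h]; omega)
  · rfl

/-- The spectral estimate behind the Poincaré inequality on a level: on functions with mean zero
that live on the configurations with `k` negative spins, `U D` is at most `(k - 1) (N - k)`.
The commutation relation turns the estimate for `k` into the one for `k + 1`. -/
theorem sum_downSum_sq_le (k : ℕ) : k ≤ N → ∀ f : Hypercube N → ℝ,
    (∀ σ, minusCount σ ≠ k → f σ = 0) → ∑ σ, f σ = 0 →
    ∑ σ, downSum f σ ^ 2 ≤ ((k : ℝ) - 1) * (N - k) * ∑ σ, f σ ^ 2 := by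
  induction k with
  | zero =>
    intro _ f hf h0
    have h1 : f 1 = 0 := by
      rw [← h0, Finset.sum_eq_single (1 : Hypercube N)]
      · intro σ _ hσ
        exact hf σ (fun h => hσ ((minusCount_eq_zero_iff σ).1 h))
      · simp
    have h2 : f = 0 := by
      funext σ
      by_cases h : minusCount σ = 0
      · rw [(minusCount_eq_zero_iff σ).1 h, h1]; rfl
      · exact hf σ h
    simp [h2, downSum]
  | succ k ih =>
    intro hk f hf h0
    set h := downSum f with hh
    have hsupp : ∀ σ, minusCount σ ≠ k → h σ = 0 := downSum_eq_zero_of_support hf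
    have hsum : ∑ σ, h σ = 0 := by
      rw [hh, sum_downSum]
      have : ∀ σ, (minusCount σ : ℝ) * f σ = (k + 1 : ℕ) * f σ := by
        intro σ
        by_cases hσ : minusCount σ = k + 1
        · rw [hσ]
        · rw [hf σ hσ]; simp
      simp_rw [this]
      rw [← Finset.mul_sum, h0, mul_zero]
    have h1 := ih (by omega) h hsupp hsum
    have h2 := sum_upSum_sq h
    have h3 : ∑ σ, ((N : ℝ) - 2 * minusCount σ) * h σ ^ 2 = (N - 2 * k) * ∑ σ, h σ ^ 2 := by
      rw [Finset.mul_sum]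
      refine Finset.sum_congr rfl fun σ _ => ?_
      by_cases hσ : minusCount σ = k
      · rw [hσ]
      · rw [hsupp σ hσ]; simp
    have h4 : ∑ σ, h σ ^ 2 = ∑ σ, f σ * upSum h σ := by
      rw [sum_mul_upSum]
      simp only [sq, hh]
    have h5 := Finset.sum_mul_sq_le_sq_mul_sq Finset.univ f (upSum h)
    rw [← h4] at h5
    set X := ∑ σ, h σ ^ 2
    set Y := ∑ σ, f σ ^ 2
    have hX : 0 ≤ X := Finset.sum_nonneg fun _ _ => sq_nonneg _
    have hY : 0 ≤ Y := Finset.sum_nonneg fun _ _ => sq_nonneg _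
    have hkN : (k : ℝ) + 1 ≤ N := by exact_mod_cast hk
    have hc : 0 ≤ (k : ℝ) * (N - (k + 1)) := mul_nonneg (by positivity) (by linarith)
    have h6 : ∑ σ, upSum h σ ^ 2 ≤ k * (N - (k + 1)) * X := by
      rw [h2, h3]; nlinarith
    have h7 : X ^ 2 ≤ Y * (k * (N - (k + 1)) * X) := h5.trans (by gcongr)
    push_cast
    rcases hX.eq_or_lt with h8 | h8
    · rw [← h8]; simp only [add_sub_cancel_right]; positivity
    · have : X * X ≤ (k * (N - (k + 1)) * Y) * X := by nlinarith
      simpa using le_of_mul_le_mul_right this h8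

end Hypercube

/-! ### The Poincaré inequality on a level of the hypercube -/

namespace Hypercube

variable {N : ℕ}

/-- The configurations with exactly `k` negative spins. -/
def level (N k : ℕ) : Finset (Hypercube N) := Finset.univ.filter fun σ => minusCount σ = k

@[simp] theorem mem_level {k : ℕ} {σ : Hypercube N} : σ ∈ level N k ↔ minusCount σ = k := by
  simp [level]

/-- The mean value of `f` on a level (zero if the level is empty). -/
noncomputable def levelMean (f : Hypercube N → ℝ) (k : ℕ) : ℝ :=
  (∑ σ ∈ level N k, f σ) / (level N k).card

/-- The sum of the squared differences of `f` over the edges from level `k` to level `k - 1`. -/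
def levelEnergy (f : Hypercube N → ℝ) (k : ℕ) : ℝ :=
  ∑ σ ∈ level N k, ∑ i, if σ i = -1 then (f σ - f (flip i σ)) ^ 2 else 0

theorem levelEnergy_nonneg (f : Hypercube N → ℝ) (k : ℕ) : 0 ≤ levelEnergy f k :=
  Finset.sum_nonneg fun _ _ => Finset.sum_nonneg fun _ _ => by positivity

theorem sum_level_edges_comm (k : ℕ) (F : Hypercube N → Hypercube N → ℝ) :
    ∑ σ ∈ level N (k + 1), ∑ i, (if σ i = -1 then F σ (flip i σ) else 0) =
      ∑ σ ∈ level N k, ∑ i, if σ i = 1 then F (flip i σ) σ else 0 := by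
  have h := sum_edges_comm (fun σ τ => if minusCount σ = k + 1 then F σ τ else 0)
  simp only [level, Finset.sum_filter, Finset.ite_sum_zero] at h ⊢
  refine (Finset.sum_congr rfl fun σ _ => Finset.sum_congr rfl fun i _ => ?_).trans
    (h.trans (Finset.sum_congr rfl fun σ _ => Finset.sum_congr rfl fun i _ => ?_))
  · split_ifs <;> rfl
  · by_cases h1 : σ i = 1
    · simp only [h1, if_true, minusCount_flip_of_eq_one h1, add_left_inj]
    · simp [h1]

theorem sum_edges_level_left (k : ℕ) (f : Hypercube N → ℝ) :
    ∑ σ ∈ level N k, ∑ i, (if σ i = -1 then f σ else 0) = k * ∑ σ ∈ level N k, f σ := by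
  rw [Finset.mul_sum]
  refine Finset.sum_congr rfl fun σ hσ => ?_
  rw [← mem_level.1 hσ, minusCount_cast, Finset.sum_mul]
  exact Finset.sum_congr rfl fun i _ => by split_ifs <;> simp

theorem sum_edges_level_right (k : ℕ) (f : Hypercube N → ℝ) :
    ∑ σ ∈ level N k, ∑ i, (if σ i = 1 then f σ else 0) = (N - k) * ∑ σ ∈ level N k, f σ := by
  rw [Finset.mul_sum]
  refine Finset.sum_congr rfl fun σ hσ => ?_
  rw [← mem_level.1 hσ, ← plusCount_cast, Finset.sum_mul]
  exact Finset.sum_congr rfl fun i _ => by split_ifs <;> simp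

theorem card_level_succ (k : ℕ) :
    ((k : ℝ) + 1) * (level N (k + 1)).card = (N - k) * (level N k).card := by
  have h := sum_level_edges_comm (N := N) k (fun _ _ => 1)
  have h1 := sum_edges_level_left (N := N) (k + 1) (fun _ => 1)
  have h2 := sum_edges_level_right (N := N) k (fun _ => 1)
  simp only [Finset.sum_const, nsmul_eq_mul, mul_one] at h1 h2
  push_cast at h1
  rw [← h1, ← h2, h]

theorem card_level_pos {k : ℕ} (hk : k ≤ N) : 0 < ((level N k).card : ℝ) := by
  induction k with
  | zero =>
    have : (1 : Hypercube N) ∈ level N 0 := by rw [mem_level, minusCount_eq_zero_iff]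
    exact_mod_cast Finset.card_pos.2 ⟨_, this⟩
  | succ k ih =>
    have h1 := ih (by omega)
    have h2 := card_level_succ (N := N) k
    have h3 : (k : ℝ) + 1 ≤ N := by exact_mod_cast hk
    have h4 : 0 < ((N : ℝ) - k) * (level N k).card := mul_pos (by linarith) h1
    rw [← h2] at h4
    exact pos_of_mul_pos_right h4 (by positivity)

theorem card_mul_levelMean {k : ℕ} (hk : k ≤ N) (f : Hypercube N → ℝ) :
    (level N k).card * levelMean f k = ∑ σ ∈ level N k, f σ := by
  have := card_level_pos hk
  rw [levelMean]; field_simp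

/-- Jensen's inequality for the edges between two neighbouring levels: the uniform distribution on
these edges projects to the uniform distribution on either level. -/
theorem sq_levelMean_sub_le {k : ℕ} (hk : k + 1 ≤ N) (f : Hypercube N → ℝ) :
    ((k : ℝ) + 1) * (level N (k + 1)).card * (levelMean f (k + 1) - levelMean f k) ^ 2 ≤
      levelEnergy f (k + 1) := by
  set c := levelMean f (k + 1) - levelMean f k with hc
  have h0 : 0 ≤ ∑ σ ∈ level N (k + 1), ∑ i,
      (if σ i = -1 then (f σ - f (flip i σ) - c) ^ 2 else 0) :=
    Finset.sum_nonneg fun _ _ => Finset.sum_nonneg fun _ _ => by positivity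
  have e1 := sum_edges_level_left (k + 1) f
  have e2 := sum_edges_level_right k f
  have e3 := sum_level_edges_comm k (fun _ τ => f τ)
  have e4 := sum_edges_level_left (N := N) (k + 1) (fun _ => 1)
  have e5 : ∑ σ ∈ level N (k + 1), ∑ i,
      (if σ i = -1 then (f σ - f (flip i σ) - c) ^ 2 else 0) =
      levelEnergy f (k + 1) - 2 * c * (∑ σ ∈ level N (k + 1), ∑ i, (if σ i = -1 then f σ else 0))
        + 2 * c * (∑ σ ∈ level N (k + 1), ∑ i, (if σ i = -1 then f (flip i σ) else 0))
        + c ^ 2 * ∑ σ ∈ level N (k + 1), ∑ i, (if σ i = -1 then 1 else 0) := by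
    simp only [levelEnergy, Finset.mul_sum, ← Finset.sum_sub_distrib, ← Finset.sum_add_distrib]
    refine Finset.sum_congr rfl fun σ _ => Finset.sum_congr rfl fun i _ => ?_
    split_ifs <;> ring
  rw [e3, e2, e1, e4, ← card_mul_levelMean hk f, ← card_mul_levelMean (by omega : k ≤ N) f] at e5
  have e6 := card_level_succ (N := N) k
  simp only [Finset.sum_const, nsmul_eq_mul, mul_one] at e5
  push_cast at e5
  rw [← mul_assoc ((N : ℝ) - k), ← e6] at e5
  rw [e5] at h0
  nlinarith

/-- The Poincaré inequality on a level, with the energy of the edges to the level below. -/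
theorem sum_level_sub_mean_sq_le {k : ℕ} (hk : k ≤ N) (f : Hypercube N → ℝ) :
    ∑ σ ∈ level N k, (f σ - levelMean f k) ^ 2 ≤ levelEnergy f k := by
  obtain _ | k := k
  · refine le_trans (le_of_eq ?_) (levelEnergy_nonneg f 0)
    have h1 : level N 0 = {1} := by
      ext σ; rw [mem_level, minusCount_eq_zero_iff, Finset.mem_singleton]
    simp [levelMean, h1]
  set c := levelMean f (k + 1) with hc
  set g : Hypercube N → ℝ := fun σ => if minusCount σ = k + 1 then f σ - c else 0 with hg
  have hg1 : ∀ σ ∈ level N (k + 1), g σ = f σ - c := fun σ hσ => by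
    simp [hg, mem_level.1 hσ]
  have hg0 : ∀ σ, minusCount σ ≠ k + 1 → g σ = 0 := fun σ hσ => by simp [hg, hσ]
  have hgs : ∀ F : ℝ → ℝ, F 0 = 0 → ∑ σ, F (g σ) = ∑ σ ∈ level N (k + 1), F (f σ - c) := by
    intro F hF
    rw [level, Finset.sum_filter]
    refine Finset.sum_congr rfl fun σ _ => ?_
    simp only [hg]
    split_ifs <;> simp [hF]
  have hsum : ∑ σ, g σ = 0 := by
    rw [hgs (fun x => x) rfl, Finset.sum_sub_distrib, ← card_mul_levelMean hk]
    simp [hc]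
  have hsp := sum_downSum_sq_le (k + 1) hk g hg0 hsum
  rw [hgs (fun x => x ^ 2) (by simp)] at hsp
  have hkN : (k : ℝ) + 1 ≤ N := by exact_mod_cast hk
  -- on the edges above a fixed `ρ` in level `k`, the squares are smallest if the value at `ρ`
  -- is replaced by the mean value over the neighbours
  have hloc : ∀ ρ ∈ level N k, (N - k : ℝ) * ∑ i, (if ρ i = 1 then g (flip i ρ) ^ 2 else 0) -
      downSum g ρ ^ 2 ≤ (N - k) * ∑ i, if ρ i = 1 then (f (flip i ρ) - f ρ) ^ 2 else 0 := by
    intro ρ hρ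
    set d := f ρ - c with hd
    have h1 : ∑ i, (if ρ i = 1 then (f (flip i ρ) - f ρ) ^ 2 else 0) =
        ∑ i, (if ρ i = 1 then g (flip i ρ) ^ 2 else 0) - 2 * d * downSum g ρ + d ^ 2 * (N - k) := by
      rw [← mem_level.1 hρ, ← plusCount_cast, downSum, Finset.mul_sum, Finset.mul_sum,
        ← Finset.sum_sub_distrib, ← Finset.sum_add_distrib]
      refine Finset.sum_congr rfl fun i _ => ?_
      split_ifs with h
      · rw [hg1 _ (by rw [mem_level, minusCount_flip_of_eq_one h, mem_level.1 hρ])]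
        ring
      · ring
    rw [h1]
    nlinarith [sq_nonneg (downSum g ρ - d * (N - k))]
  have hE : levelEnergy f (k + 1) =
      ∑ ρ ∈ level N k, ∑ i, if ρ i = 1 then (f (flip i ρ) - f ρ) ^ 2 else 0 :=
    sum_level_edges_comm k (fun σ τ => (f σ - f τ) ^ 2)
  have hV : ((k + 1 : ℕ) : ℝ) * ∑ σ ∈ level N (k + 1), (f σ - c) ^ 2 =
      ∑ ρ ∈ level N k, ∑ i, (if ρ i = 1 then g (flip i ρ) ^ 2 else 0) := by
    rw [← sum_level_edges_comm k (fun σ _ => g σ ^ 2), sum_edges_level_left (k + 1)]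
    congr 1
    exact Finset.sum_congr rfl fun σ hσ => by rw [hg1 σ hσ]
  have hD : ∑ ρ ∈ level N k, downSum g ρ ^ 2 = ∑ σ, downSum g σ ^ 2 := by
    refine Finset.sum_subset (Finset.subset_univ _) fun σ _ hσ => ?_
    rw [downSum_eq_zero_of_support hg0 σ (fun h => hσ (mem_level.2 h))]; simp
  have htot := Finset.sum_le_sum hloc
  rw [Finset.sum_sub_distrib, ← Finset.mul_sum, ← Finset.mul_sum, ← hE, ← hV, hD] at htot
  push_cast at htot hsp
  set X := ∑ σ ∈ level N (k + 1), (f σ - c) ^ 2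
  have hX : 0 ≤ X := Finset.sum_nonneg fun _ _ => sq_nonneg _
  have h1 : (N : ℝ) * X ≤ (N - k) * levelEnergy f (k + 1) := by nlinarith
  have h2 : ((N : ℝ) - k) * X ≤ (N - k) * levelEnergy f (k + 1) := by
    have : 0 ≤ (k : ℝ) * X := by positivity
    nlinarith
  exact le_of_mul_le_mul_left h2 (by linarith)

end Hypercube

/-! ### The Hardy inequality for the magnetization -/

section OneDimensional

theorem sum_Ioc_one_div_le_log {p m : ℕ} (h : p < m) :
    ∑ j ∈ Finset.Ioc p m, 1 / (j : ℝ) ≤ 1 + Real.log (m / (p + 1)) := by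
  induction m, h using Nat.le_induction with
  | base =>
    have h0 : ((p : ℝ) + 1) ≠ 0 := by positivity
    simp [div_self h0]
    exact inv_le_one_of_one_le₀ (by linarith [(Nat.cast_nonneg p : (0 : ℝ) ≤ p)])
  | succ m hm ih =>
    have hm0 : (0 : ℝ) < m := by exact_mod_cast (by omega : 0 < m)
    rw [Finset.sum_Ioc_succ_top (by omega)]
    have h1 := Real.one_sub_inv_le_log_of_pos (x := ((m : ℝ) + 1) / m) (by positivity)
    have h2 : Real.log (((m + 1 : ℕ) : ℝ) / (p + 1)) =
        Real.log (m / (p + 1)) + Real.log (((m : ℝ) + 1) / m) := by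
      rw [← Real.log_mul (by positivity) (by positivity)]
      congr 1; push_cast; field_simp
    have h3 : 1 - (((m : ℝ) + 1) / m)⁻¹ = 1 / ((m + 1 : ℕ) : ℝ) := by
      push_cast; field_simp; ring
    rw [h2]; linarith

theorem sum_Ioc_sub_pred (φ : ℕ → ℝ) {a b : ℕ} (h : a ≤ b) :
    ∑ j ∈ Finset.Ioc a b, (φ j - φ (j - 1)) = φ b - φ a := by
  induction b, h using Nat.le_induction with
  | base => simp
  | succ b hb ih => rw [Finset.sum_Ioc_succ_top (by omega), ih]; simp

/-- A weighted Poincaré (Hardy) inequality on `{0, …, m}` for weights `w` that increase up to `p`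
and decrease afterwards, with conductance `j * w j` between `j - 1` and `j`. Beyond `p` the
increments are weighted with `1 / j` in the Cauchy-Schwarz inequality, so that only a harmonic sum
is lost. -/
theorem sum_unimodal_sub_sq_le {m p : ℕ} (hp : p ≤ m) {w : ℕ → ℝ} (hw : ∀ k, 0 ≤ w k)
    (hup : ∀ x j, x ≤ j → j ≤ p → w x ≤ w j)
    (hdown : ∀ j y, p ≤ j → j ≤ y → y ≤ m → w y ≤ w j) {c : ℝ} (hc1 : 1 ≤ c)
    (hc : ∑ j ∈ Finset.Ioc p m, 1 / (j : ℝ) ≤ c) (φ : ℕ → ℝ) :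
    ∑ k ∈ Finset.range (m + 1), w k * (φ k - φ p) ^ 2 ≤
      m * c * ∑ j ∈ Finset.Ioc 0 m, j * w j * (φ j - φ (j - 1)) ^ 2 := by
  set D : ℕ → ℝ := fun j => (φ j - φ (j - 1)) ^ 2 with hD
  have hD0 : ∀ j, 0 ≤ D j := fun j => sq_nonneg _
  have hright : ∑ y ∈ Finset.Ioc p m, w y * (φ y - φ p) ^ 2 ≤
      m * c * ∑ j ∈ Finset.Ioc p m, j * w j * D j := by
    calc ∑ y ∈ Finset.Ioc p m, w y * (φ y - φ p) ^ 2
        ≤ ∑ y ∈ Finset.Ioc p m, ∑ j ∈ Finset.Ioc p y, c * (j * D j) * w y := by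
          refine Finset.sum_le_sum fun y hy => ?_
          rw [Finset.mem_Ioc] at hy
          rw [← Finset.sum_mul, ← Finset.mul_sum, mul_comm]
          refine mul_le_mul_of_nonneg_right ?_ (hw y)
          rw [← sum_Ioc_sub_pred φ hy.1.le]
          refine (Finset.sum_sq_le_sum_mul_sum_of_sq_le_mul _ (f := fun j : ℕ => 1 / (j : ℝ))
            (g := fun j : ℕ => (j : ℝ) * D j) (fun _ _ => by positivity)
            (fun j _ => mul_nonneg (by positivity) (hD0 j)) fun j hj => ?_).trans ?_
          · rw [Finset.mem_Ioc] at hj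
            have : (j : ℝ) ≠ 0 := by exact_mod_cast (by omega : j ≠ 0)
            exact le_of_eq (by simp only [hD]; field_simp)
          · refine mul_le_mul_of_nonneg_right (le_trans ?_ hc)
              (Finset.sum_nonneg fun j _ => mul_nonneg (by positivity) (hD0 j))
            exact Finset.sum_le_sum_of_subset_of_nonneg
              (Finset.Ioc_subset_Ioc_right hy.2) fun _ _ _ => by positivity
      _ = ∑ j ∈ Finset.Ioc p m, ∑ y ∈ Finset.Icc j m, c * (j * D j) * w y :=
          Finset.sum_comm' fun y j => by simp only [Finset.mem_Ioc, Finset.mem_Icc]; omega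
      _ ≤ ∑ j ∈ Finset.Ioc p m, m * c * (j * w j * D j) := by
          refine Finset.sum_le_sum fun j hj => ?_
          rw [Finset.mem_Ioc] at hj
          have h1 : ∑ y ∈ Finset.Icc j m, w y ≤ m * w j := by
            calc _ ≤ ∑ y ∈ Finset.Icc j m, w j := Finset.sum_le_sum fun y hy => by
                  rw [Finset.mem_Icc] at hy
                  exact hdown j y hj.1.le hy.1 hy.2
              _ = ((m + 1 - j : ℕ) : ℝ) * w j := by simp
              _ ≤ m * w j := mul_le_mul_of_nonneg_right
                  (by exact_mod_cast (by omega : m + 1 - j ≤ m)) (hw j)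
          rw [← Finset.mul_sum]
          calc _ ≤ c * (j * D j) * (m * w j) := mul_le_mul_of_nonneg_left h1
                (mul_nonneg (by linarith) (mul_nonneg (by positivity) (hD0 j)))
            _ = _ := by ring
      _ = _ := by rw [Finset.mul_sum]
  have hleft : ∑ x ∈ Finset.range p, w x * (φ x - φ p) ^ 2 ≤
      m * c * ∑ j ∈ Finset.Ioc 0 p, j * w j * D j := by
    calc ∑ x ∈ Finset.range p, w x * (φ x - φ p) ^ 2
        ≤ ∑ x ∈ Finset.range p, ∑ j ∈ Finset.Ioc x p, m * D j * w x := by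
          refine Finset.sum_le_sum fun x hx => ?_
          rw [Finset.mem_range] at hx
          rw [← Finset.sum_mul, ← Finset.mul_sum, mul_comm]
          refine mul_le_mul_of_nonneg_right ?_ (hw x)
          rw [← neg_sub (φ p), neg_sq, ← sum_Ioc_sub_pred φ hx.le]
          refine sq_sum_le_card_mul_sum_sq.trans ?_
          refine mul_le_mul_of_nonneg_right ?_ (Finset.sum_nonneg fun j _ => hD0 j)
          rw [Nat.card_Ioc]
          exact_mod_cast (by omega : p - x ≤ m)
      _ = ∑ j ∈ Finset.Ioc 0 p, ∑ x ∈ Finset.range j, m * D j * w x :=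
          Finset.sum_comm' fun x j => by simp only [Finset.mem_Ioc, Finset.mem_range]; omega
      _ ≤ ∑ j ∈ Finset.Ioc 0 p, m * c * (j * w j * D j) := by
          refine Finset.sum_le_sum fun j hj => ?_
          rw [Finset.mem_Ioc] at hj
          have h1 : ∑ x ∈ Finset.range j, w x ≤ j * w j := by
            calc _ ≤ ∑ x ∈ Finset.range j, w j := Finset.sum_le_sum fun x hx =>
                  hup x j (Finset.mem_range.1 hx).le hj.2
              _ = j * w j := by simp
          rw [← Finset.mul_sum]
          have h2 : 0 ≤ (m : ℝ) * D j := mul_nonneg (by positivity) (hD0 j)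
          have h3 : 0 ≤ (m : ℝ) * D j * (j * w j) := mul_nonneg h2 (mul_nonneg (by positivity) (hw j))
          nlinarith [mul_le_mul_of_nonneg_left h1 h2]
      _ = _ := by rw [Finset.mul_sum]
  have e1 : ∑ k ∈ Finset.range (m + 1), w k * (φ k - φ p) ^ 2 =
      ∑ x ∈ Finset.range p, w x * (φ x - φ p) ^ 2 +
        ∑ y ∈ Finset.Ioc p m, w y * (φ y - φ p) ^ 2 := by
    have h1 : Finset.Ioc p m = Finset.Ico (p + 1) (m + 1) := by ext; simp
    rw [← Finset.sum_range_add_sum_Ico _ (by omega : p + 1 ≤ m + 1), Finset.sum_range_succ, h1]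
    simp
  have e2 : ∑ j ∈ Finset.Ioc 0 m, j * w j * D j =
      ∑ j ∈ Finset.Ioc 0 p, j * w j * D j + ∑ j ∈ Finset.Ioc p m, j * w j * D j :=
    (Finset.sum_Ioc_consecutive _ (Nat.zero_le p) hp).symm
  rw [e1, e2, mul_add]
  exact add_le_add hleft hright

/-- The function `x ↦ artanh x / x` is nondecreasing on `(0, 1)`. -/
theorem log_sub_log_le_of_le {c x y : ℝ} (hy : 0 < y) (hyx : y ≤ x) (hx : x < 1)
    (h : Real.log (1 + x) - Real.log (1 - x) ≤ c * x) :
    Real.log (1 + y) - Real.log (1 - y) ≤ c * y := by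
  have hx0 : 0 < x := hy.trans_le hyx
  have sx := Real.hasSum_log_sub_log_of_abs_lt_one (x := x) (by rw [abs_of_pos hx0]; exact hx)
  have sy := Real.hasSum_log_sub_log_of_abs_lt_one (x := y)
    (by rw [abs_of_pos hy]; exact hyx.trans_lt hx)
  have h1 := hasSum_le (fun k => ?_) sy (sx.mul_left (y / x))
  · calc _ ≤ y / x * (c * x) := h1.trans (mul_le_mul_of_nonneg_left h (by positivity))
      _ = c * y := by field_simp
  · have h2 : y ^ (2 * k + 1) ≤ y / x * x ^ (2 * k + 1) := by
      have : y / x * x ^ (2 * k + 1) = y * x ^ (2 * k) := by rw [pow_succ]; field_simp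
      rw [this, pow_succ, mul_comm]
      gcongr
    calc _ ≤ 2 * (1 / (2 * (k : ℝ) + 1)) * (y / x * x ^ (2 * k + 1)) := by gcongr
      _ = _ := by ring

end OneDimensional

namespace Hypercube

/-- The (unnormalized) weight of the level with `k` negative spins under the Curie–Weiss measure at
inverse temperature `t`. -/
noncomputable def levelWeight (N : ℕ) (t : ℝ) (k : ℕ) : ℝ :=
  (level N k).card * Real.exp (t * ((N : ℝ) - 2 * k) ^ 2 / (2 * N))

theorem levelWeight_succ_le_iff {N k : ℕ} (hk : k + 1 ≤ N) (t : ℝ) :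
    levelWeight N t (k + 1) ≤ levelWeight N t k ↔
      ((N : ℝ) - k) / (k + 1) ≤ Real.exp (2 * t * (N - 2 * k - 1) / N) := by
  have h1 := card_level_succ (N := N) k
  have h2 := card_level_pos (N := N) (k := k) (by omega)
  have hN : (0 : ℝ) < N := by exact_mod_cast (by omega : 0 < N)
  have h3 : ((level N (k + 1)).card : ℝ) = (N - k) / (k + 1) * (level N k).card := by
    field_simp; linarith
  have h4 : Real.exp (t * ((N : ℝ) - 2 * k) ^ 2 / (2 * N)) =
      Real.exp (2 * t * (N - 2 * k - 1) / N) *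
        Real.exp (t * ((N : ℝ) - 2 * (k + 1 : ℕ)) ^ 2 / (2 * N)) := by
    rw [← Real.exp_add]
    congr 1
    push_cast
    field_simp
    ring
  have h5 := Real.exp_pos (t * ((N : ℝ) - 2 * (k + 1 : ℕ)) ^ 2 / (2 * N))
  unfold levelWeight
  rw [h3, h4]
  rw [show ((N : ℝ) - k) / (k + 1) * (level N k).card *
      Real.exp (t * ((N : ℝ) - 2 * (k + 1 : ℕ)) ^ 2 / (2 * N)) = ((N : ℝ) - k) / (k + 1) *
      ((level N k).card * Real.exp (t * ((N : ℝ) - 2 * (k + 1 : ℕ)) ^ 2 / (2 * N))) by ring,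
    show (level N k).card * (Real.exp (2 * t * (N - 2 * k - 1) / N) *
      Real.exp (t * ((N : ℝ) - 2 * (k + 1 : ℕ)) ^ 2 / (2 * N))) =
      Real.exp (2 * t * (N - 2 * k - 1) / N) * ((level N k).card *
      Real.exp (t * ((N : ℝ) - 2 * (k + 1 : ℕ)) ^ 2 / (2 * N))) by ring]
  exact mul_le_mul_iff_left₀ (by positivity)

/-- Once the level weights of the positively magnetized half decrease, they go on decreasing. -/
theorem levelWeight_succ_le_of_le {m k l : ℕ} (t : ℝ) (hkl : k ≤ l) (hl : l < m)
    (h : levelWeight (2 * m + 1) t (k + 1) ≤ levelWeight (2 * m + 1) t k) :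
    levelWeight (2 * m + 1) t (l + 1) ≤ levelWeight (2 * m + 1) t l := by
  set N := 2 * m + 1 with hN
  have hN0 : (0 : ℝ) < N := by positivity
  have key : ∀ j : ℕ, j < m → (levelWeight N t (j + 1) ≤ levelWeight N t j ↔
      Real.log (1 + ((N : ℝ) - 2 * j - 1) / (N + 1)) - Real.log (1 - ((N : ℝ) - 2 * j - 1) / (N + 1))
        ≤ 2 * t * (N + 1) / N * (((N : ℝ) - 2 * j - 1) / (N + 1))) := by
    intro j hj
    have hj' : (j : ℝ) + 1 ≤ m := by exact_mod_cast hj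
    have hNm : (N : ℝ) = 2 * m + 1 := by rw [hN]; push_cast; ring
    have hj0 : (0 : ℝ) ≤ j := by positivity
    rw [levelWeight_succ_le_iff (by omega)]
    have e1 : 1 + ((N : ℝ) - 2 * j - 1) / (N + 1) = (N - j) * (2 / (N + 1)) := by field_simp; ring
    have e2 : 1 - ((N : ℝ) - 2 * j - 1) / (N + 1) = (j + 1) * (2 / (N + 1)) := by field_simp; ring
    have hNj : (0 : ℝ) < N - j := by linarith
    rw [e1, e2, Real.log_mul (by positivity) (by positivity),
      Real.log_mul (by positivity) (by positivity), add_sub_add_right_eq_sub,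
      ← Real.log_div (by positivity) (by positivity), ← Real.log_le_iff_le_exp (by positivity)]
    have e3 : 2 * t * (N + 1) / N * (((N : ℝ) - 2 * j - 1) / (N + 1)) =
      2 * t * (N - 2 * j - 1) / N := by field_simp
    rw [e3]
  rw [key l hl]
  have hl' : (l : ℝ) + 1 ≤ m := by exact_mod_cast hl
  have hkl' : (k : ℝ) ≤ l := by exact_mod_cast hkl
  have hNm : (N : ℝ) = 2 * m + 1 := by rw [hN]; push_cast; ring
  have hk0 : (0 : ℝ) ≤ k := by positivity
  refine log_sub_log_le_of_le ?_ ?_ ?_ ((key k (by omega)).1 h)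
  · exact div_pos (by linarith) (by linarith)
  · gcongr
  · rw [div_lt_one (by linarith)]; linarith

/-- The level weights of the positively magnetized half are unimodal. At low temperature the mode
`p` may be close to `0`, but `p + 1` is at least `exp (-2 t) m`, which bounds the harmonic sum. -/
theorem exists_mode (m : ℕ) {t : ℝ} (ht : 0 ≤ t) : ∃ p ≤ m,
    (∀ x j, x ≤ j → j ≤ p → levelWeight (2 * m + 1) t x ≤ levelWeight (2 * m + 1) t j) ∧
    (∀ j y, p ≤ j → j ≤ y → y ≤ m →
      levelWeight (2 * m + 1) t y ≤ levelWeight (2 * m + 1) t j) ∧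
    ∑ j ∈ Finset.Ioc p m, 1 / (j : ℝ) ≤ 1 + 2 * t := by
  classical
  set w := levelWeight (2 * m + 1) t with hw
  have hex : ∃ k, k = m ∨ w (k + 1) ≤ w k := ⟨m, Or.inl rfl⟩
  set p := Nat.find hex with hp
  have hpm : p ≤ m := Nat.find_min' hex (Or.inl rfl)
  have hbelow : ∀ k < p, w k ≤ w (k + 1) := fun k hk => by
    have := Nat.find_min hex hk
    push Not at this
    exact this.2.le
  have hspec := Nat.find_spec hex
  rw [← hp] at hspec
  refine ⟨p, hpm, ?_, ?_, ?_⟩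
  · intro x j hxj
    induction j, hxj using Nat.le_induction with
    | base => intro _; exact le_rfl
    | succ j hj ih => intro h; exact (ih (by omega)).trans (hbelow j (by omega))
  · intro j y hpj hjy
    induction y, hjy using Nat.le_induction with
    | base => intro _; exact le_rfl
    | succ y hy ih =>
      intro h
      refine le_trans ?_ (ih (by omega))
      exact levelWeight_succ_le_of_le t (hpj.trans hy) (by omega)
        (hspec.resolve_left (by omega))
  · rcases hpm.eq_or_lt with h | h
    · rw [h]; simp; linarith
    · refine (sum_Ioc_one_div_le_log h).trans ?_
      have h1 := (levelWeight_succ_le_iff (N := 2 * m + 1) (k := p) (by omega) t).1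
        (hspec.resolve_left (by omega))
      have hp' : (p : ℝ) + 1 ≤ m := by exact_mod_cast h
      have hp0 : (0 : ℝ) ≤ p := by positivity
      have h2 : (m : ℝ) / (p + 1) ≤ Real.exp (2 * t) := by
        calc (m : ℝ) / (p + 1) ≤ (((2 * m + 1 : ℕ) : ℝ) - p) / (p + 1) := by
              gcongr; push_cast; linarith
          _ ≤ _ := h1
          _ ≤ Real.exp (2 * t) := by
              rw [Real.exp_le_exp, div_le_iff₀ (by positivity)]
              push_cast
              nlinarith
      have h3 := Real.log_le_log (by
        have : (0 : ℝ) < m := by linarith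
        positivity) h2
      rw [Real.log_exp] at h3
      linarith

end Hypercube

/-! ### The local Poincaré inequality -/

namespace Hypercube

/-- The unnormalized Curie–Weiss weight `exp (-t H(σ))`, in terms of the number of negative
spins. -/
noncomputable def spinWeight (N : ℕ) (t : ℝ) (σ : Hypercube N) : ℝ :=
  Real.exp (t * ((N : ℝ) - 2 * minusCount σ) ^ 2 / (2 * N))

theorem sum_level_sub_sq {N k : ℕ} (hk : k ≤ N) (f : Hypercube N → ℝ) (c : ℝ) :
    ∑ σ ∈ level N k, (f σ - c) ^ 2 =
      ∑ σ ∈ level N k, (f σ - levelMean f k) ^ 2 + (level N k).card * (levelMean f k - c) ^ 2 := by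
  have h := card_mul_levelMean hk f
  have h1 : ∑ σ ∈ level N k, (f σ - c) ^ 2 = ∑ σ ∈ level N k, ((f σ - levelMean f k) ^ 2 +
      2 * (levelMean f k - c) * f σ + (c ^ 2 - levelMean f k ^ 2)) :=
    Finset.sum_congr rfl fun σ _ => by ring
  rw [h1, Finset.sum_add_distrib, Finset.sum_add_distrib, ← Finset.mul_sum, ← h]
  simp only [Finset.sum_const, nsmul_eq_mul]
  ring

/-- The local Poincaré inequality on the configurations with positive magnetization. The constant
grows only linearly with the inverse temperature. -/
theorem exists_poincare_half {N m : ℕ} (hN : N = 2 * m + 1) {t : ℝ} (ht : 0 ≤ t)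
    (f : Hypercube N → ℝ) :
    ∃ c, ∑ σ with minusCount σ ≤ m, spinWeight N t σ * (f σ - c) ^ 2 ≤
      (1 + m * (1 + 2 * t)) * ∑ σ with minusCount σ ≤ m, spinWeight N t σ *
        ∑ i, if σ i = -1 then (f σ - f (flip i σ)) ^ 2 else 0 := by
  obtain ⟨p, hpm, hup, hdown, hharm⟩ := exists_mode m ht
  rw [← hN] at hup hdown
  set w := levelWeight N t with hw
  set e : ℕ → ℝ := fun k => Real.exp (t * ((N : ℝ) - 2 * k) ^ 2 / (2 * N)) with he
  have he0 : ∀ k, 0 ≤ e k := fun k => (Real.exp_pos _).le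
  have hwe : ∀ k, w k = (level N k).card * e k := fun k => rfl
  have hw0 : ∀ k, 0 ≤ w k := fun k => mul_nonneg (by positivity) (he0 k)
  have hfib : ∀ F : Hypercube N → ℝ, ∑ σ with minusCount σ ≤ m, spinWeight N t σ * F σ =
      ∑ k ∈ Finset.range (m + 1), e k * ∑ σ ∈ level N k, F σ := by
    intro F
    rw [← Finset.sum_fiberwise_of_maps_to (s := Finset.univ.filter fun σ : Hypercube N =>
      minusCount σ ≤ m) (t := Finset.range (m + 1)) (g := minusCount)
      (fun σ hσ => Finset.mem_range.2 (Nat.lt_succ_of_le (Finset.mem_filter.1 hσ).2))]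
    refine Finset.sum_congr rfl fun k hk => ?_
    rw [Finset.mul_sum]
    refine Finset.sum_congr ?_ fun σ hσ => ?_
    · ext σ
      rw [Finset.mem_range] at hk
      simp only [Finset.mem_filter, Finset.mem_univ, true_and, mem_level]
      omega
    · rw [spinWeight, mem_level.1 hσ]
  refine ⟨levelMean f p, ?_⟩
  rw [hfib, hfib]
  have hEe : ∀ k, (∑ σ ∈ level N k, ∑ i, if σ i = -1 then (f σ - f (flip i σ)) ^ 2 else 0) =
    levelEnergy f k := fun k => rfl
  simp only [hEe]
  set E := ∑ k ∈ Finset.range (m + 1), e k * levelEnergy f k with hE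
  have h1 : ∑ k ∈ Finset.range (m + 1), e k * ∑ σ ∈ level N k, (f σ - levelMean f p) ^ 2 ≤
      E + ∑ k ∈ Finset.range (m + 1), w k * (levelMean f k - levelMean f p) ^ 2 := by
    rw [hE, ← Finset.sum_add_distrib]
    refine Finset.sum_le_sum fun k hk => ?_
    rw [Finset.mem_range] at hk
    rw [sum_level_sub_sq (by omega), hwe]
    have := mul_le_mul_of_nonneg_left (sum_level_sub_mean_sq_le (by omega : k ≤ N) f) (he0 k)
    linarith
  have h2 := sum_unimodal_sub_sq_le hpm hw0 hup hdown (by linarith) hharm (levelMean f)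
  have h3 : ∑ j ∈ Finset.Ioc 0 m, j * w j * (levelMean f j - levelMean f (j - 1)) ^ 2 ≤ E := by
    calc _ ≤ ∑ j ∈ Finset.Ioc 0 m, e j * levelEnergy f j := by
          refine Finset.sum_le_sum fun j hj => ?_
          rw [Finset.mem_Ioc] at hj
          obtain ⟨j, rfl⟩ : ∃ i, j = i + 1 := ⟨j - 1, by omega⟩
          have h4 := mul_le_mul_of_nonneg_left
            (sq_levelMean_sub_le (by omega : j + 1 ≤ N) f) (he0 (j + 1))
          rw [hwe, Nat.add_sub_cancel]
          refine le_trans (le_of_eq ?_) h4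
          push_cast; ring
      _ ≤ E := Finset.sum_le_sum_of_subset_of_nonneg
          (fun j hj => by rw [Finset.mem_Ioc] at hj; rw [Finset.mem_range]; omega)
          fun j _ _ => mul_nonneg (he0 j) (levelEnergy_nonneg f j)
  have h4 : (m : ℝ) * (1 + 2 * t) *
      ∑ j ∈ Finset.Ioc 0 m, j * w j * (levelMean f j - levelMean f (j - 1)) ^ 2 ≤
      m * (1 + 2 * t) * E := mul_le_mul_of_nonneg_left h3 (by positivity)
  calc _ ≤ _ := h1
    _ ≤ E + m * (1 + 2 * t) * E := by linarith
    _ = _ := by ring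

end Hypercube

/-! ### The forward equation and the evolution of the error -/

section ForwardEquation

/-- Grönwall's inequality for a one-sided bound on the derivative. -/
theorem le_exp_mul_of_hasDerivWithinAt_le {f f' : ℝ → ℝ} {T c : ℝ}
    (hf : ∀ t ∈ Set.Icc 0 T, HasDerivWithinAt f (f' t) (Set.Ici 0) t)
    (hf' : ∀ t ∈ Set.Icc 0 T, f' t ≤ c * f t) {t : ℝ} (ht : t ∈ Set.Icc 0 T) :
    f t ≤ Real.exp (c * t) * f 0 := by
  have hd : ∀ t ∈ Set.Icc 0 T, HasDerivWithinAt (fun u => Real.exp (-c * u) * f u)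
      (Real.exp (-c * t) * (f' t - c * f t)) (Set.Ici 0) t := by
    intro t ht
    have h1 : HasDerivAt (fun u => Real.exp (-c * u)) (Real.exp (-c * t) * (-c * 1)) t :=
      ((hasDerivAt_id t).const_mul (-c)).exp
    exact (h1.hasDerivWithinAt.mul (hf t ht)).congr_deriv (by ring)
  have hanti : AntitoneOn (fun u => Real.exp (-c * u) * f u) (Set.Icc 0 T) := by
    have hmem : ∀ x ∈ interior (Set.Icc 0 T), x ∈ Set.Icc 0 T ∧ Set.Ici (0 : ℝ) ∈ nhds x := by
      intro x hx
      rw [interior_Icc] at hx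
      exact ⟨Set.Ioo_subset_Icc_self hx, Ici_mem_nhds hx.1⟩
    refine antitoneOn_of_deriv_nonpos (convex_Icc 0 T)
      (fun t ht => (hd t ht).continuousWithinAt.mono Set.Icc_subset_Ici_self) ?_ ?_
    · exact fun x hx =>
        ((hd x (hmem x hx).1).hasDerivAt (hmem x hx).2).differentiableAt.differentiableWithinAt
    · intro x hx
      rw [((hd x (hmem x hx).1).hasDerivAt (hmem x hx).2).deriv]
      exact mul_nonpos_of_nonneg_of_nonpos (Real.exp_pos _).le
        (sub_nonpos.2 (hf' x (hmem x hx).1))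
  have h := hanti ⟨le_rfl, ht.1.trans ht.2⟩ ht ht.1
  simp only [mul_zero, Real.exp_zero, one_mul] at h
  calc f t = Real.exp (c * t) * (Real.exp (-c * t) * f t) := by
        rw [← mul_assoc, ← Real.exp_add]; simp
    _ ≤ _ := by gcongr

theorem hasDerivAt_sq_min_zero (u : ℝ) :
    HasDerivAt (fun x : ℝ => min x 0 ^ 2) (2 * min u 0) u := by
  rcases lt_trichotomy u 0 with h | h | h
  · rw [min_eq_left h.le]
    have h1 : HasDerivAt (fun x : ℝ => x ^ 2) (2 * u) u := by simpa using hasDerivAt_pow 2 u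
    refine h1.congr_of_eventuallyEq ?_
    filter_upwards [Iio_mem_nhds h] with x hx
    rw [min_eq_left (le_of_lt hx)]
  · subst h
    rw [min_self, mul_zero, hasDerivAt_iff_isLittleO]
    have h1 : (fun x : ℝ => x ^ 2) =o[nhds 0] fun x : ℝ => x :=
      Asymptotics.isLittleO_pow_id one_lt_two
    simp only [min_self, smul_zero, sub_zero, ne_eq, OfNat.ofNat_ne_zero, not_false_eq_true,
      zero_pow]
    refine Asymptotics.IsBigO.trans_isLittleO ?_ h1
    refine Asymptotics.isBigO_of_le _ fun x => ?_
    rw [norm_pow, norm_pow]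
    refine pow_le_pow_left₀ (norm_nonneg _) ?_ 2
    rcases le_total x 0 with hx | hx
    · rw [min_eq_left hx]
    · rw [min_eq_right hx]; simp
  · rw [min_eq_right h.le, mul_zero]
    refine (hasDerivAt_const u (0 : ℝ)).congr_of_eventuallyEq ?_
    filter_upwards [Ioi_mem_nhds h] with x hx
    rw [min_eq_right (le_of_lt hx)]; simp

variable {S : Type*} [Fintype S]

/-- A linear equation `q' = q A` whose off-diagonal coefficients are nonnegative preserves
nonnegativity: the squared distance to the positive cone satisfies Grönwall's inequality. -/
theorem nonneg_of_hasDerivWithinAt_vecMul {A : ℝ → Matrix S S ℝ}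
    (hA : ContinuousOn A (Set.Ici 0)) (hoff : ∀ t, 0 ≤ t → ∀ x y, x ≠ y → 0 ≤ A t x y)
    {q : ℝ → S → ℝ}
    (hq : ∀ t, 0 ≤ t → ∀ x, HasDerivWithinAt (fun u => q u x) ((q t ᵥ* A t) x) (Set.Ici 0) t)
    (h0 : ∀ x, 0 ≤ q 0 x) {T : ℝ} (hT : 0 ≤ T) (x : S) : 0 ≤ q T x := by
  have hK : ∃ K, 0 ≤ K ∧ ∀ t ∈ Set.Icc 0 T, ∀ x y, |A t x y| ≤ K := by
    have h1 : ∀ x y, ∃ K, 0 ≤ K ∧ ∀ t ∈ Set.Icc 0 T, |A t x y| ≤ K := by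
      intro x y
      have hc : ContinuousOn (fun t => A t x y) (Set.Icc 0 T) :=
        ((continuous_apply_apply x y).comp_continuousOn hA).mono Set.Icc_subset_Ici_self
      obtain ⟨K, hK⟩ := isCompact_Icc.exists_bound_of_continuousOn hc
      exact ⟨max K 0, le_max_right _ _, fun t ht => (hK t ht).trans (le_max_left _ _)⟩
    choose K hK0 hK using h1
    refine ⟨∑ x, ∑ y, K x y, Finset.sum_nonneg fun x _ => Finset.sum_nonneg fun y _ => hK0 x y,
      fun t ht x y => (hK x y t ht).trans ?_⟩
    exact (Finset.single_le_sum (f := fun y => K x y) (fun y _ => hK0 x y)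
      (Finset.mem_univ y)).trans (Finset.single_le_sum (f := fun x => ∑ y, K x y)
        (fun x _ => Finset.sum_nonneg fun y _ => hK0 x y) (Finset.mem_univ x))
  obtain ⟨K, hK0, hK⟩ := hK
  set n : ℝ → S → ℝ := fun t x => min (q t x) 0 with hn
  have hn0 : ∀ t x, n t x ≤ 0 := fun t x => min_le_right _ _
  have hnq : ∀ t x, n t x ≤ q t x := fun t x => min_le_left _ _
  have hnn : ∀ t x, n t x * q t x = n t x * n t x := by
    intro t x
    simp only [hn]
    rcases le_total (q t x) 0 with h | h
    · rw [min_eq_left h]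
    · rw [min_eq_right h]; simp
  have hd : ∀ t ∈ Set.Icc 0 T, HasDerivWithinAt (fun u => ∑ x, n u x ^ 2)
      (∑ x, 2 * n t x * (q t ᵥ* A t) x) (Set.Ici 0) t := by
    intro t ht
    refine HasDerivWithinAt.fun_sum fun x _ => ?_
    have h := (hasDerivAt_sq_min_zero (q t x)).comp_hasDerivWithinAt t (hq t ht.1 x)
    exact h
  have hb : ∀ t ∈ Set.Icc 0 T, ∑ x, 2 * n t x * (q t ᵥ* A t) x ≤
      (2 * K * Fintype.card S) * ∑ x, n t x ^ 2 := by
    intro t ht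
    calc ∑ x, 2 * n t x * (q t ᵥ* A t) x
        = ∑ x, ∑ y, 2 * (n t x * q t y * A t y x) := by
          refine Finset.sum_congr rfl fun x _ => ?_
          rw [Matrix.vecMul, dotProduct, Finset.mul_sum]
          exact Finset.sum_congr rfl fun y _ => by ring
      _ ≤ ∑ x, ∑ y, K * (n t x ^ 2 + n t y ^ 2) := by
          refine Finset.sum_le_sum fun x _ => Finset.sum_le_sum fun y _ => ?_
          have h1 : n t x * q t y * A t y x ≤ n t x * n t y * A t y x := by
            by_cases h : y = x
            · subst h; rw [hnn]
            · exact mul_le_mul_of_nonneg_right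
                (mul_le_mul_of_nonpos_left (hnq t y) (hn0 t x)) (hoff t ht.1 y x h)
          have h2 : n t x * n t y * A t y x ≤ n t x * n t y * K :=
            mul_le_mul_of_nonneg_left ((le_abs_self _).trans (hK t ht y x))
              (mul_nonneg_of_nonpos_of_nonpos (hn0 t x) (hn0 t y))
          nlinarith [mul_nonneg hK0 (sq_nonneg (n t x - n t y))]
      _ = _ := by
          simp only [← Finset.mul_sum, Finset.sum_add_distrib, Finset.sum_const, nsmul_eq_mul,
            Finset.card_univ]
          ring
  have hfin := le_exp_mul_of_hasDerivWithinAt_le hd hb ⟨hT, le_rfl⟩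
  have hz : ∑ x, n 0 x ^ 2 = 0 :=
    Finset.sum_eq_zero fun x _ => by simp [hn, min_eq_right (h0 x)]
  rw [hz, mul_zero] at hfin
  have h1 : n T x ^ 2 ≤ 0 := (Finset.single_le_sum (f := fun x => n T x ^ 2)
    (fun _ _ => sq_nonneg _) (Finset.mem_univ x)).trans hfin
  have h2 : n T x = 0 := pow_eq_zero_iff two_ne_zero |>.1 (le_antisymm h1 (sq_nonneg _))
  rw [← h2]; exact hnq T x

/-- The Dirichlet form of a reversible generator. -/
noncomputable def dirichletForm (π : S → ℝ) (L : Matrix S S ℝ) (f : S → ℝ) : ℝ :=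
  1 / 2 * ∑ x, ∑ y, π x * L x y * (f x - f y) ^ 2

theorem sum_mul_mul_eq_neg_dirichletForm {π : S → ℝ} {L : Matrix S S ℝ}
    (hrev : ∀ x y, π x * L x y = π y * L y x) (hrow : ∀ x, ∑ y, L x y = 0) (f : S → ℝ) :
    ∑ x, f x * ∑ y, f y * π y * L y x = -dirichletForm π L f := by
  have h1 : ∑ x, ∑ y, π x * L x y * f x ^ 2 = 0 := by
    refine Finset.sum_eq_zero fun x _ => ?_
    rw [← Finset.sum_mul, ← Finset.mul_sum, hrow]; simp
  have h2 : ∑ x, ∑ y, π x * L x y * f y ^ 2 = 0 := by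
    rw [Finset.sum_comm, ← h1]
    exact Finset.sum_congr rfl fun x _ => Finset.sum_congr rfl fun y _ => by rw [hrev y x]
  have h3 : ∑ x, ∑ y, π x * L x y * (f x - f y) ^ 2 =
      ∑ x, ∑ y, π x * L x y * f x ^ 2 + ∑ x, ∑ y, π x * L x y * f y ^ 2 -
        2 * ∑ x, f x * ∑ y, f y * π y * L y x := by
    simp only [Finset.mul_sum, ← Finset.sum_add_distrib, ← Finset.sum_sub_distrib]
    refine Finset.sum_congr rfl fun x _ => Finset.sum_congr rfl fun y _ => ?_
    rw [show 2 * (f x * (f y * π y * L y x)) = 2 * f x * f y * (π y * L y x) by ring, ← hrev x y]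
    ring
  rw [dirichletForm, h3, h1, h2]; ring

theorem hasDerivAt_gibbs [Nonempty S] {μ H : S → ℝ} (hμ : ∀ x, 0 < μ x) (t : ℝ) (x : S) :
    HasDerivAt (fun u => gibbs μ H u x)
      ((expect (gibbs μ H t) H - H x) * gibbs μ H t x) t := by
  have h1 : ∀ y, HasDerivAt (fun u => Real.exp (-u * H y) * μ y)
      (-H y * (Real.exp (-t * H y) * μ y)) t := by
    intro y
    have h : HasDerivAt (fun u : ℝ => -u * H y) (-1 * H y) t :=
      (hasDerivAt_id t).neg.mul_const (H y)
    exact (h.exp.mul_const (μ y)).congr_deriv (by ring)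
  have hZ : 0 < ∑ y, Real.exp (-t * H y) * μ y :=
    Finset.sum_pos (fun y _ => mul_pos (Real.exp_pos _) (hμ y)) Finset.univ_nonempty
  have h2 := HasDerivAt.fun_sum (u := Finset.univ) fun y _ => h1 y
  have h3 := (h1 x).div h2 hZ.ne'
  have hE : expect (gibbs μ H t) H = (∑ y, H y * (Real.exp (-t * H y) * μ y)) /
      ∑ y, Real.exp (-t * H y) * μ y := by
    unfold expect gibbs
    rw [Finset.sum_div]
    exact Finset.sum_congr rfl fun y _ => by ring
  refine h3.congr_deriv ?_
  rw [hE]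
  unfold gibbs
  simp only [neg_mul, Finset.sum_neg_distrib] at hZ ⊢
  field_simp
  ring

theorem sum_gibbs [Nonempty S] {μ H : S → ℝ} (hμ : ∀ x, 0 < μ x) (t : ℝ) :
    ∑ x, gibbs μ H t x = 1 := by
  unfold gibbs
  rw [← Finset.sum_div]
  exact div_self (Finset.sum_pos (fun y _ => mul_pos (Real.exp_pos _) (hμ y))
    Finset.univ_nonempty).ne'

theorem gibbs_pos [Nonempty S] {μ H : S → ℝ} (hμ : ∀ x, 0 < μ x) (t : ℝ) (x : S) :
    0 < gibbs μ H t x :=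
  div_pos (mul_pos (Real.exp_pos _) (hμ x)) (Finset.sum_pos
    (fun y _ => mul_pos (Real.exp_pos _) (hμ y)) Finset.univ_nonempty)

variable [DecidableEq S]

theorem vecMul_killedGenerator (M : ℝ → ℝ) (L : ℝ → Matrix S S ℝ) (H : S → ℝ) (t : ℝ)
    (v : S → ℝ) (x : S) :
    (v ᵥ* killedGenerator M L H t) x = M t * ∑ y, v y * L t y x - H x * v x := by
  rw [killedGenerator, Matrix.vecMul_sub, Pi.sub_apply, Matrix.vecMul_smul, Pi.smul_apply,
    Matrix.vecMul_diagonal, smul_eq_mul, Matrix.vecMul, dotProduct]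
  ring

theorem sum_vecMul_killedGenerator {M : ℝ → ℝ} {L : ℝ → Matrix S S ℝ} {t : ℝ}
    (hrow : ∀ x, ∑ y, L t x y = 0) (H v : S → ℝ) :
    ∑ x, (v ᵥ* killedGenerator M L H t) x = -∑ x, H x * v x := by
  simp only [vecMul_killedGenerator, Finset.sum_sub_distrib, ← Finset.mul_sum]
  rw [Finset.sum_comm]
  simp only [← Finset.mul_sum, hrow]
  simp

/-- The evolution of the mean square error. With `h = ν_t / μ_t - 1`, the derivative consists of
the dissipation by the Dirichlet form and of two terms produced by the change of `μ_t`. -/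
theorem hasDerivWithinAt_meanSquareError [Nonempty S] {μ H : S → ℝ} (hμ : ∀ x, 0 < μ x)
    {M : ℝ → ℝ} {L : ℝ → Matrix S S ℝ} {q : ℝ → S → ℝ} {t : ℝ}
    (hq : ∀ x, HasDerivWithinAt (fun u => q u x)
      ((q t ᵥ* killedGenerator M L H t) x) (Set.Ici 0) t)
    (hz : ∑ x, q t x ≠ 0)
    (hrev : ∀ x y, gibbs μ H t x * L t x y = gibbs μ H t y * L t y x)
    (hrow : ∀ x, ∑ y, L t x y = 0) {h : S → ℝ}
    (hh : ∀ x, h x = ((∑ y, q t y)⁻¹ • q t) x / gibbs μ H t x - 1) :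
    HasDerivWithinAt (fun u => meanSquareError ((∑ y, q u y)⁻¹ • q u) (gibbs μ H u))
      (2 * expect (gibbs μ H t) (fun x => h x ^ 2) * expect (gibbs μ H t) (fun x => h x * H x)
        - expect (gibbs μ H t) (fun x => h x ^ 2 * (H x - expect (gibbs μ H t) H))
        - 2 * M t * dirichletForm (gibbs μ H t) (L t) h) (Set.Ici 0) t := by
  set π := gibbs μ H t with hπ
  set z := ∑ y, q t y with hzdef
  set ν : S → ℝ := z⁻¹ • q t with hν
  have hπ0 : ∀ x, π x ≠ 0 := fun x => (gibbs_pos hμ t x).ne'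
  have hπ1 : ∑ x, π x = 1 := sum_gibbs hμ t
  have hν1 : ∑ x, ν x = 1 := by
    simp only [hν, Pi.smul_apply, smul_eq_mul, ← Finset.mul_sum]
    exact inv_mul_cancel₀ hz
  have hνh : ∀ x, ν x = (1 + h x) * π x := fun x => by
    rw [hh x]; have := hπ0 x; field_simp; ring
  have hqν : ∀ x, q t x = z * ν x := fun x => by
    simp only [hν, Pi.smul_apply, smul_eq_mul]; field_simp
  have dz : HasDerivWithinAt (fun u => ∑ y, q u y) (-∑ x, H x * q t x) (Set.Ici 0) t := by
    rw [← sum_vecMul_killedGenerator (M := M) hrow]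
    exact HasDerivWithinAt.fun_sum fun x _ => hq x
  have dν : ∀ x, HasDerivWithinAt (fun u => ((∑ y, q u y)⁻¹ • q u) x)
      (M t * ∑ y, ν y * L t y x + (∑ y, H y * ν y - H x) * ν x) (Set.Ici 0) t := by
    intro x
    refine ((dz.inv hz).mul (hq x)).congr_deriv ?_
    rw [vecMul_killedGenerator]
    rw [Pi.inv_apply, ← hzdef, show ∑ y, H y * q t y = z * ∑ y, H y * ν y by
        rw [Finset.mul_sum]; exact Finset.sum_congr rfl fun y _ => by rw [hqν]; ring,
      show ∑ y, q t y * L t y x = z * ∑ y, ν y * L t y x by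
        rw [Finset.mul_sum]; exact Finset.sum_congr rfl fun y _ => by rw [hqν]; ring, hqν x]
    field_simp
    ring
  have dterm : ∀ x, HasDerivWithinAt (fun u =>
      (((∑ y, q u y)⁻¹ • q u) x / gibbs μ H u x - 1) ^ 2 * gibbs μ H u x)
      (2 * M t * (h x * ∑ y, ν y * L t y x)
        + 2 * (∑ y, H y * ν y - expect π H) * (h x * (1 + h x) * π x)
        - h x ^ 2 * (H x - expect π H) * π x) (Set.Ici 0) t := by
    intro x
    have dπ := (hasDerivAt_gibbs (H := H) hμ t x).hasDerivWithinAt (s := Set.Ici 0)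
    refine (((((dν x).div dπ (hπ0 x)).sub_const 1).pow 2).mul dπ).congr_deriv ?_
    have hx := hπ0 x
    simp only [← hπ, ← hzdef, ← hν, Pi.div_apply, Pi.pow_apply]
    rw [hνh x]
    field_simp
    ring
  refine (HasDerivWithinAt.fun_sum (u := Finset.univ) fun x _ => dterm x).congr_deriv ?_
  rw [Finset.sum_sub_distrib, Finset.sum_add_distrib, ← Finset.mul_sum, ← Finset.mul_sum]
  have e0 : ∑ x, h x * π x = 0 := by
    have : ∑ x, ν x = ∑ x, π x + ∑ x, h x * π x := by
      rw [← Finset.sum_add_distrib]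
      exact Finset.sum_congr rfl fun x _ => by rw [hνh]; ring
    linarith
  have e1 : ∑ x, h x * ∑ y, ν y * L t y x = -dirichletForm π (L t) h := by
    rw [← sum_mul_mul_eq_neg_dirichletForm hrev hrow h]
    refine Finset.sum_congr rfl fun x _ => ?_
    congr 1
    have : ∑ y, π y * L t y x = 0 := by
      simp only [fun y => hrev y x, ← Finset.mul_sum, hrow, mul_zero]
    rw [← zero_add (∑ y, h y * π y * L t y x), ← this, ← Finset.sum_add_distrib]
    exact Finset.sum_congr rfl fun y _ => by rw [hνh]; ring
  have e2 : ∑ y, H y * ν y - expect π H = expect π fun x => h x * H x := by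
    unfold expect
    rw [← Finset.sum_sub_distrib]
    exact Finset.sum_congr rfl fun y _ => by rw [hνh]; ring
  have e3 : ∑ x, h x * (1 + h x) * π x = expect π fun x => h x ^ 2 := by
    unfold expect
    rw [← zero_add (∑ x, h x ^ 2 * π x), ← e0, ← Finset.sum_add_distrib]
    exact Finset.sum_congr rfl fun y _ => by ring
  rw [e1, e2, e3]
  simp only [expect]
  ring

end ForwardEquation

/-! ### The Dirichlet form of the Metropolis dynamics -/

section Metropolis

variable {S : Type*} [Fintype S] [DecidableEq S]

theorem mul_metropolis_of_ne {π : S → ℝ} (hπ : ∀ x, 0 < π x) (K : Matrix S S ℝ) {x y : S}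
    (hxy : x ≠ y) : π x * metropolis K π x y = K x y * min (π y) (π x) := by
  rw [metropolis, if_neg hxy, mul_left_comm, mul_min_of_nonneg _ _ (hπ x).le, mul_one,
    mul_div_cancel₀ _ (hπ x).ne']

theorem metropolis_reversible {π : S → ℝ} (hπ : ∀ x, 0 < π x) {K : Matrix S S ℝ}
    (hK : ∀ x y, K x y = K y x) (x y : S) :
    π x * metropolis K π x y = π y * metropolis K π y x := by
  by_cases h : x = y
  · rw [h]
  · rw [mul_metropolis_of_ne hπ K h, mul_metropolis_of_ne hπ K (Ne.symm h), hK x y, min_comm]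

theorem sum_metropolis (K : Matrix S S ℝ) (π : S → ℝ) (x : S) : ∑ y, metropolis K π x y = 0 := by
  rw [← Finset.add_sum_erase _ _ (Finset.mem_univ x), metropolis, if_pos rfl, neg_add_eq_zero]
  refine Finset.sum_congr rfl fun y hy => ?_
  simp only [metropolis, if_neg (Finset.ne_of_mem_erase hy).symm]

theorem metropolis_nonneg_of_ne {π : S → ℝ} (hπ : ∀ x, 0 < π x) {K : Matrix S S ℝ}
    (hK : ∀ x y, 0 ≤ K x y) {x y : S} (hxy : x ≠ y) : 0 ≤ metropolis K π x y := by
  rw [metropolis, if_neg hxy]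
  exact mul_nonneg (hK x y) (le_min (div_nonneg (hπ y).le (hπ x).le) zero_le_one)

end Metropolis

namespace Hypercube

variable {N : ℕ}

theorem hammingDist_flip (i : Fin N) (σ : Hypercube N) : hammingDist σ (flip i σ) = 1 := by
  rw [hammingDist, Finset.card_eq_one]
  refine ⟨i, ?_⟩
  ext j
  simp only [Finset.mem_filter, Finset.mem_univ, true_and, Finset.mem_singleton]
  constructor
  · intro h
    by_contra hj
    exact h (flip_apply_of_ne hj σ).symm
  · rintro rfl
    rw [flip_apply_self]
    rcases Int.units_eq_one_or (σ j) with h | h <;> rw [h] <;> decide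

theorem flip_ne (i : Fin N) (σ : Hypercube N) : σ ≠ flip i σ := by
  intro h
  have := hammingDist_flip i σ
  rw [← h, hammingDist_self] at this
  omega

theorem flip_left_injective (σ : Hypercube N) : Function.Injective fun i => flip i σ := by
  intro i j h
  by_contra hij
  have h1 : flip i σ i = flip j σ i := congrFun h i
  rw [flip_apply_self, flip_apply_of_ne hij] at h1
  rcases Int.units_eq_one_or (σ i) with h | h <;> rw [h] at h1 <;> revert h1 <;> decide

theorem nearestNeighborWalk_symm (σ τ : Hypercube N) :
    nearestNeighborWalk N σ τ = nearestNeighborWalk N τ σ := by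
  simp only [nearestNeighborWalk, hammingDist_comm]

theorem nearestNeighborWalk_nonneg (σ τ : Hypercube N) : 0 ≤ nearestNeighborWalk N σ τ := by
  unfold nearestNeighborWalk; positivity

theorem uniformHypercube_pos (σ : Hypercube N) : 0 < uniformHypercube N σ := by
  unfold uniformHypercube; positivity

theorem curieWeissMeasure_pos (t : ℝ) (σ : Hypercube N) : 0 < curieWeissMeasure N t σ :=
  gibbs_pos uniformHypercube_pos t σ

theorem sum_curieWeissMeasure (t : ℝ) : ∑ σ, curieWeissMeasure N t σ = 1 :=
  sum_gibbs uniformHypercube_pos t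

theorem curieWeissEnergy_eq (σ : Hypercube N) :
    curieWeissEnergy N σ = -(((N : ℝ) - 2 * minusCount σ) ^ 2 / (2 * N)) := by
  rw [curieWeissEnergy, ← sum_spin, sq, Finset.sum_mul_sum]
  ring

theorem curieWeissEnergy_nonpos (σ : Hypercube N) : curieWeissEnergy N σ ≤ 0 := by
  rw [curieWeissEnergy_eq, neg_nonpos]; positivity

theorem sq_magnetization_le (σ : Hypercube N) : ((N : ℝ) - 2 * minusCount σ) ^ 2 ≤ (N : ℝ) ^ 2 := by
  have h1 : (minusCount σ : ℝ) ≤ N := by exact_mod_cast minusCount_le σ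
  have h0 : (0 : ℝ) ≤ minusCount σ := by positivity
  nlinarith

theorem neg_half_le_curieWeissEnergy (σ : Hypercube N) :
    -((N : ℝ) / 2) ≤ curieWeissEnergy N σ := by
  rw [curieWeissEnergy_eq, neg_le_neg_iff]
  rcases Nat.eq_zero_or_pos N with h | h
  · subst h; simp
  · have hN : (0 : ℝ) < N := by exact_mod_cast h
    rw [div_le_div_iff₀ (by positivity) (by positivity)]
    nlinarith [sq_magnetization_le σ]

theorem sq_magnetization_neg (σ : Hypercube N) :
    ((N : ℝ) - 2 * minusCount (-σ)) ^ 2 = ((N : ℝ) - 2 * minusCount σ) ^ 2 := by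
  rw [minusCount_neg, Nat.cast_sub (minusCount_le σ)]; ring

theorem curieWeissEnergy_neg (σ : Hypercube N) :
    curieWeissEnergy N (-σ) = curieWeissEnergy N σ := by
  rw [curieWeissEnergy_eq, curieWeissEnergy_eq, sq_magnetization_neg]

theorem exp_neg_mul_curieWeissEnergy (t : ℝ) (σ : Hypercube N) :
    Real.exp (-t * curieWeissEnergy N σ) = spinWeight N t σ := by
  rw [spinWeight, curieWeissEnergy_eq]; congr 1; ring

theorem curieWeissMeasure_eq (t : ℝ) (σ : Hypercube N) :
    curieWeissMeasure N t σ = (∑ τ, spinWeight N t τ)⁻¹ * spinWeight N t σ := by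
  have h : (1 : ℝ) / 2 ^ N ≠ 0 := by positivity
  simp only [curieWeissMeasure, gibbs, exp_neg_mul_curieWeissEnergy, uniformHypercube,
    ← Finset.sum_mul]
  rw [mul_div_mul_right _ _ h, div_eq_inv_mul]

theorem curieWeissMeasure_neg (t : ℝ) (σ : Hypercube N) :
    curieWeissMeasure N t (-σ) = curieWeissMeasure N t σ := by
  simp only [curieWeissMeasure_eq, spinWeight, sq_magnetization_neg]

theorem curieWeissMeasure_le {t : ℝ} (ht : 0 ≤ t) {σ τ : Hypercube N}
    (h : ((N : ℝ) - 2 * minusCount σ) ^ 2 ≤ ((N : ℝ) - 2 * minusCount τ) ^ 2) :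
    curieWeissMeasure N t σ ≤ curieWeissMeasure N t τ := by
  have h0 : 0 ≤ (∑ τ : Hypercube N, spinWeight N t τ)⁻¹ :=
    inv_nonneg.2 (Finset.sum_nonneg fun _ _ => (Real.exp_pos _).le)
  rw [curieWeissMeasure_eq, curieWeissMeasure_eq]
  refine mul_le_mul_of_nonneg_left (Real.exp_le_exp.2 ?_) h0
  gcongr

/-- The energy of `f` on the edges that leave a configuration with at most `m` negative spins by
turning a negative spin positive; for `N = 2 m + 1` these are the edges inside the half with
positive magnetization. -/
noncomputable def halfEnergy (N m : ℕ) (t : ℝ) (f : Hypercube N → ℝ) : ℝ :=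
  ∑ σ with minusCount σ ≤ m, curieWeissMeasure N t σ *
    ∑ i, if σ i = -1 then (f σ - f (flip i σ)) ^ 2 else 0

theorem sum_edges_min_le_dirichletForm (t : ℝ) (f : Hypercube N → ℝ) :
    ∑ σ, ∑ i, min (curieWeissMeasure N t (flip i σ)) (curieWeissMeasure N t σ) *
        (f σ - f (flip i σ)) ^ 2 ≤
      2 * N * dirichletForm (curieWeissMeasure N t) (curieWeissMetropolis N t) f := by
  rw [dirichletForm, show ∀ x : ℝ, 2 * (N : ℝ) * (1 / 2 * x) = N * x from fun x => by ring,
    Finset.mul_sum]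
  refine Finset.sum_le_sum fun σ _ => ?_
  set F : Hypercube N → ℝ := fun τ =>
    curieWeissMeasure N t σ * curieWeissMetropolis N t σ τ * (f σ - f τ) ^ 2 with hF
  have hF0 : ∀ τ, 0 ≤ F τ := by
    intro τ
    by_cases h : σ = τ
    · subst h; simp [hF]
    · exact mul_nonneg (mul_nonneg (curieWeissMeasure_pos t σ).le (metropolis_nonneg_of_ne
        (curieWeissMeasure_pos t) nearestNeighborWalk_nonneg h)) (sq_nonneg _)
  have h1 : ∑ i, F (flip i σ) ≤ ∑ τ, F τ := by
    rw [← Finset.sum_image (g := fun i => flip i σ) (fun i _ j _ h => flip_left_injective σ h)]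
    exact Finset.sum_le_sum_of_subset_of_nonneg (Finset.subset_univ _) fun τ _ _ => hF0 τ
  refine le_trans (le_of_eq ?_) (mul_le_mul_of_nonneg_left h1 (Nat.cast_nonneg N))
  rw [Finset.mul_sum]
  refine Finset.sum_congr rfl fun i _ => ?_
  have hN : (N : ℝ) ≠ 0 := by exact_mod_cast (Nat.pos_of_ne_zero fun h => by
    subst h; exact i.elim0).ne'
  simp only [hF]
  rw [curieWeissMetropolis, mul_metropolis_of_ne (curieWeissMeasure_pos t) _ (flip_ne i σ),
    nearestNeighborWalk, if_pos (hammingDist_flip i σ)]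
  field_simp

/-- The Dirichlet form dominates the energies of the two halves of the hypercube. -/
theorem halfEnergy_add_halfEnergy_le {m : ℕ} (hN : N = 2 * m + 1) {t : ℝ} (ht : 0 ≤ t)
    (f : Hypercube N → ℝ) :
    halfEnergy N m t f + halfEnergy N m t (fun σ => f (-σ)) ≤
      N * dirichletForm (curieWeissMeasure N t) (curieWeissMetropolis N t) f := by
  set π := curieWeissMeasure N t with hπ
  have hcount : ∀ σ : Hypercube N, minusCount σ ≤ N := minusCount_le
  have hNm : (N : ℝ) = 2 * m + 1 := by rw [hN]; push_cast; ring
  set A : Hypercube N → Hypercube N → ℝ := fun σ τ =>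
    if minusCount σ ≤ m then π σ * (f σ - f τ) ^ 2 else 0 with hA
  set B : Hypercube N → Hypercube N → ℝ := fun σ τ =>
    if minusCount (-σ) ≤ m then π σ * (f σ - f τ) ^ 2 else 0 with hB
  have e1 : halfEnergy N m t f = ∑ σ, ∑ i, if σ i = -1 then A σ (flip i σ) else 0 := by
    rw [halfEnergy, Finset.sum_filter]
    refine Finset.sum_congr rfl fun σ _ => ?_
    simp only [hA, Finset.mul_sum, mul_ite, mul_zero]
    split_ifs
    · rfl
    · simp
  have e2 : halfEnergy N m t (fun σ => f (-σ)) =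
      ∑ σ, ∑ i, if σ i = 1 then B σ (flip i σ) else 0 := by
    rw [halfEnergy, Finset.sum_filter, ← sum_comp_neg]
    refine Finset.sum_congr rfl fun σ _ => ?_
    simp only [hB, Finset.mul_sum, mul_ite, mul_zero, Pi.neg_apply, spin_neg_eq_neg_one_iff,
      neg_flip, neg_neg, curieWeissMeasure_neg, hπ]
    split_ifs <;> simp
  have e1' := e1.trans (sum_edges_comm A)
  have e2' := e2.trans (sum_edges_comm fun σ τ => B τ σ).symm
  have hmain := sum_edges_min_le_dirichletForm t f
  have hle : (∑ σ, ∑ i, if σ i = -1 then A σ (flip i σ) else 0) +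
      (∑ σ, ∑ i, if σ i = 1 then A (flip i σ) σ else 0) +
      (∑ σ, ∑ i, if σ i = 1 then B σ (flip i σ) else 0) +
      (∑ σ, ∑ i, if σ i = -1 then B (flip i σ) σ else 0) ≤
      ∑ σ, ∑ i, min (π (flip i σ)) (π σ) * (f σ - f (flip i σ)) ^ 2 := by
    simp only [← Finset.sum_add_distrib]
    refine Finset.sum_le_sum fun σ _ => Finset.sum_le_sum fun i _ => ?_
    -- for each edge at most one of the four terms is not zero
    have hsq : (f (flip i σ) - f σ) ^ 2 = (f σ - f (flip i σ)) ^ 2 := by ring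
    have hcase : ∀ a b : Hypercube N, minusCount b + 1 = minusCount a →
        A a b + B b a ≤ min (π b) (π a) * (f a - f b) ^ 2 := by
      intro a b hab
      have hab' : (minusCount b : ℝ) + 1 = minusCount a := by exact_mod_cast hab
      simp only [hA, hB, minusCount_neg]
      have hmin : 0 ≤ min (π b) (π a) :=
        le_min (curieWeissMeasure_pos t b).le (curieWeissMeasure_pos t a).le
      rcases le_or_gt (minusCount a) m with h | h
      · have h' : (minusCount a : ℝ) ≤ m := by exact_mod_cast h
        rw [if_pos h, if_neg (by omega), add_zero, min_eq_right]
        exact curieWeissMeasure_le ht (by nlinarith)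
      · rw [if_neg (by omega), zero_add]
        split_ifs with h2
        · have h' : (m : ℝ) + 1 ≤ minusCount b := by
            have := hcount b
            exact_mod_cast (by omega : m + 1 ≤ minusCount b)
          rw [min_eq_left]
          · exact le_of_eq (by ring)
          · exact curieWeissMeasure_le ht (by nlinarith)
        · positivity
    rcases Int.units_eq_one_or (σ i) with h | h
    · have := hcase (flip i σ) σ (minusCount_flip_of_eq_one h).symm
      rw [min_comm, hsq] at this
      simpa [h] using this
    · have := hcase σ (flip i σ) (minusCount_flip_of_eq_neg_one h)
      simpa [h] using this
  rw [← e1, ← e1', ← e2, ← e2'] at hle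
  linarith

/-- The sign of the magnetization of a configuration of `2 m + 1` spins. -/
def magnetizationSign (m : ℕ) (σ : Hypercube N) : ℝ := if minusCount σ ≤ m then 1 else -1

theorem magnetizationSign_sq (m : ℕ) (σ : Hypercube N) : magnetizationSign m σ ^ 2 = 1 := by
  unfold magnetizationSign; split_ifs <;> norm_num

theorem magnetizationSign_neg {m : ℕ} (hN : N = 2 * m + 1) (σ : Hypercube N) :
    magnetizationSign m (-σ) = -magnetizationSign m σ := by
  have := minusCount_le σ
  unfold magnetizationSign
  rw [minusCount_neg]
  split_ifs
  · omega
  · simp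
  · simp
  · omega

/-- By the symmetry `σ ↦ -σ`, the sign of the magnetization is orthogonal to even functions. -/
theorem sum_even_mul_magnetizationSign {m : ℕ} (hN : N = 2 * m + 1) {g : Hypercube N → ℝ}
    (hg : ∀ σ, g (-σ) = g σ) : ∑ σ, g σ * magnetizationSign m σ = 0 := by
  have h := sum_comp_neg fun σ => g σ * magnetizationSign m σ
  simp only [hg, magnetizationSign_neg hN, mul_neg, Finset.sum_neg_distrib] at h
  linarith

/-- The part of a centred function `h` that is orthogonal to the sign of the magnetization is
controlled by the Dirichlet form, with a constant polynomial in `N`. -/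
theorem sum_sub_sign_sq_le {m : ℕ} (hN : N = 2 * m + 1) {t : ℝ} (ht : 0 ≤ t)
    {h : Hypercube N → ℝ} (h0 : ∑ σ, h σ * curieWeissMeasure N t σ = 0) {a : ℝ}
    (ha : a = ∑ σ, h σ * magnetizationSign m σ * curieWeissMeasure N t σ) :
    ∑ σ, (h σ - a * magnetizationSign m σ) ^ 2 * curieWeissMeasure N t σ ≤
      (N : ℝ) ^ 2 * (1 + t) *
        dirichletForm (curieWeissMeasure N t) (curieWeissMetropolis N t) h := by
  set π := curieWeissMeasure N t with hπ
  set s : Hypercube N → ℝ := magnetizationSign m with hs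
  set Z := (∑ τ : Hypercube N, spinWeight N t τ)⁻¹ with hZ
  have hZ0 : 0 ≤ Z := inv_nonneg.2 (Finset.sum_nonneg fun _ _ => (Real.exp_pos _).le)
  have hs2 : ∀ σ, s σ ^ 2 = 1 := magnetizationSign_sq m
  have hπ1 : ∑ σ, π σ = 1 := sum_curieWeissMeasure t
  have hπs : ∑ σ, π σ * s σ = 0 :=
    sum_even_mul_magnetizationSign hN (curieWeissMeasure_neg t)
  have hhalf : ∀ f : Hypercube N → ℝ, ∃ c, ∑ σ with minusCount σ ≤ m, π σ * (f σ - c) ^ 2 ≤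
      (1 + m * (1 + 2 * t)) * halfEnergy N m t f := by
    intro f
    obtain ⟨c, hc⟩ := exists_poincare_half hN ht f
    refine ⟨c, ?_⟩
    have := mul_le_mul_of_nonneg_left hc hZ0
    have hF : ∀ F : Hypercube N → ℝ, Z * ∑ σ with minusCount σ ≤ m, spinWeight N t σ * F σ =
        ∑ σ with minusCount σ ≤ m, π σ * F σ := fun F => by
      rw [Finset.mul_sum]
      exact Finset.sum_congr rfl fun σ _ => by rw [hπ, curieWeissMeasure_eq, mul_assoc]
    rwa [mul_left_comm, hF, hF] at this
  obtain ⟨c₁, hc₁⟩ := hhalf h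
  obtain ⟨c₂, hc₂⟩ := hhalf fun σ => h (-σ)
  have hsplit : ∑ σ, π σ * (h σ - ((c₁ + c₂) / 2 + (c₁ - c₂) / 2 * s σ)) ^ 2 =
      ∑ σ with minusCount σ ≤ m, π σ * (h σ - c₁) ^ 2 +
        ∑ σ with minusCount σ ≤ m, π σ * (h (-σ) - c₂) ^ 2 := by
    rw [Finset.sum_filter, Finset.sum_filter,
      ← sum_comp_neg fun σ => if minusCount σ ≤ m then π σ * (h (-σ) - c₂) ^ 2 else 0,
      ← Finset.sum_add_distrib]
    refine Finset.sum_congr rfl fun σ _ => ?_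
    have := minusCount_le σ
    simp only [neg_neg, hπ, curieWeissMeasure_neg, hs, magnetizationSign, minusCount_neg]
    rcases le_or_gt (minusCount σ) m with h1 | h1
    · rw [if_pos h1, if_pos h1, if_neg (by omega)]; ring
    · rw [if_neg (by omega), if_neg (by omega), if_pos (by omega)]; ring
  -- `h - a s` is orthogonal to the functions of the sign, so it is the best approximation
  have hbest : ∑ σ, (h σ - a * s σ) ^ 2 * π σ ≤
      ∑ σ, π σ * (h σ - ((c₁ + c₂) / 2 + (c₁ - c₂) / 2 * s σ)) ^ 2 := by
    have e : ∑ σ, π σ * (h σ - ((c₁ + c₂) / 2 + (c₁ - c₂) / 2 * s σ)) ^ 2 =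
        ∑ σ, (h σ - a * s σ) ^ 2 * π σ - (c₁ + c₂) * ∑ σ, h σ * π σ
          + 2 * (a - (c₁ - c₂) / 2) * ∑ σ, h σ * s σ * π σ
          + (((c₁ + c₂) / 2) ^ 2 + ((c₁ - c₂) / 2) ^ 2 - a ^ 2) * ∑ σ, π σ
          + (c₁ + c₂) * (c₁ - c₂) / 2 * ∑ σ, π σ * s σ := by
      simp only [Finset.mul_sum, ← Finset.sum_sub_distrib, ← Finset.sum_add_distrib]
      refine Finset.sum_congr rfl fun σ _ => ?_
      linear_combination (π σ * (((c₁ - c₂) / 2) ^ 2 - a ^ 2)) * hs2 σ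
    rw [e, h0, ← ha, hπ1, hπs]
    nlinarith [sq_nonneg (a - (c₁ - c₂) / 2), sq_nonneg ((c₁ + c₂) / 2)]
  have hE := halfEnergy_add_halfEnergy_le hN ht h
  set D := dirichletForm π (curieWeissMetropolis N t) h with hD
  have hD0 : 0 ≤ D := by
    have h1 : ∀ f : Hypercube N → ℝ, 0 ≤ halfEnergy N m t f := fun f =>
      Finset.sum_nonneg fun σ _ => mul_nonneg (curieWeissMeasure_pos t σ).le
        (Finset.sum_nonneg fun i _ => by positivity)
    have hNpos : (0 : ℝ) < N := by rw [hN]; positivity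
    have := add_nonneg (h1 h) (h1 fun σ => h (-σ))
    exact nonneg_of_mul_nonneg_right (this.trans hE) hNpos
  have hNm : (N : ℝ) = 2 * m + 1 := by rw [hN]; push_cast; ring
  have hm0 : (0 : ℝ) ≤ m := by positivity
  have hconst : (1 + (m : ℝ) * (1 + 2 * t)) * (N * D) ≤ (N : ℝ) ^ 2 * (1 + t) * D := by
    have h1 : 1 + (m : ℝ) * (1 + 2 * t) ≤ N * (1 + t) := by rw [hNm]; nlinarith
    have h2 : 0 ≤ (N : ℝ) * D := by positivity
    nlinarith
  have hstep := mul_le_mul_of_nonneg_left hE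
    (by positivity : (0 : ℝ) ≤ 1 + m * (1 + 2 * t))
  linarith

end Hypercube

/-! ### The differential inequality for the error -/

section Static

variable {S : Type*} [Fintype S]

theorem sq_sum_mul_mul_le {π : S → ℝ} (hπ : ∀ x, 0 ≤ π x) (f g : S → ℝ) :
    (∑ x, f x * g x * π x) ^ 2 ≤ (∑ x, f x ^ 2 * π x) * ∑ x, g x ^ 2 * π x := by
  refine Finset.sum_sq_le_sum_mul_sum_of_sq_le_mul _ (fun x _ => mul_nonneg (sq_nonneg _) (hπ x))
    (fun x _ => mul_nonneg (sq_nonneg _) (hπ x)) fun x _ => le_of_eq (by ring)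

/-- The terms in the evolution of the error `∑ x, h x ^ 2 * π x` that are caused by the change of
`π`. If `s` is a sign that is uncorrelated with the energy, then the component of `h`
along `s` contributes only together with the remainder `h - a s`. -/
theorem error_growth_le {π H s h : S → ℝ} (hπ : ∀ x, 0 ≤ π x) (hπ1 : ∑ x, π x = 1)
    (hs2 : ∀ x, s x ^ 2 = 1)
    (hsH : ∑ x, (H x - expect π H) * π x * s x = 0) (h0 : ∑ x, h x * π x = 0) {a κ V D b γ : ℝ}
    (ha : a = ∑ x, h x * s x * π x) (hκ : κ = ∑ x, (h x - a * s x) ^ 2 * π x)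
    (hV : ∑ x, (H x - expect π H) ^ 2 * π x ≤ V) (hD : ∀ x, expect π H - H x ≤ D)
    (hb : 0 < b) (hγ : 0 < γ) :
    2 * expect π (fun x => h x ^ 2) * expect π (fun x => h x * H x)
        - expect π (fun x => h x ^ 2 * (H x - expect π H)) ≤
      expect π (fun x => h x ^ 2) / b + expect π (fun x => h x ^ 2) ^ 2 / (γ * b)
        + κ * (D + (1 + γ) * b * V) := by
  set m := expect π H with hm
  set k : S → ℝ := fun x => h x - a * s x with hk
  set ε := expect π fun x => h x ^ 2 with hε
  set X := ∑ x, k x * (H x - m) * π x with hX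
  set Y := ∑ x, s x * k x * (H x - m) * π x with hY
  have hκ0 : 0 ≤ κ := by
    rw [hκ]; exact Finset.sum_nonneg fun x _ => mul_nonneg (sq_nonneg _) (hπ x)
  have hVk : ∀ g : S → ℝ, ∑ x, g x ^ 2 * π x = κ → (∑ x, g x * (H x - m) * π x) ^ 2 ≤ κ * V := by
    intro g hg
    refine (sq_sum_mul_mul_le hπ g fun x => H x - m).trans ?_
    rw [hg]
    exact mul_le_mul_of_nonneg_left hV hκ0
  have hXV : X ^ 2 ≤ κ * V := hVk k hκ.symm
  have hYV : Y ^ 2 ≤ κ * V := hVk (fun x => s x * k x) (by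
    rw [hκ]
    exact Finset.sum_congr rfl fun x _ => by rw [mul_pow, hs2, one_mul])
  have hεκ : ε = κ + a ^ 2 := by
    have e : κ = ∑ x, h x ^ 2 * π x - 2 * a * ∑ x, h x * s x * π x + a ^ 2 * ∑ x, π x := by
      rw [hκ]
      simp only [Finset.mul_sum, ← Finset.sum_sub_distrib, ← Finset.sum_add_distrib]
      refine Finset.sum_congr rfl fun x _ => ?_
      linear_combination (a ^ 2 * π x) * hs2 x
    rw [← ha, hπ1] at e
    rw [hε, expect]; linarith
  have hhH : expect π (fun x => h x * H x) = X := by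
    have e : X = ∑ x, h x * H x * π x - m * ∑ x, h x * π x
        - a * ∑ x, (H x - m) * π x * s x := by
      rw [hX]
      simp only [Finset.mul_sum, ← Finset.sum_sub_distrib]
      exact Finset.sum_congr rfl fun x _ => by simp only [hk]; ring
    rw [e, h0, hsH, expect]; ring
  have hmean : ∑ x, (H x - m) * π x = 0 := by
    simp only [sub_mul, Finset.sum_sub_distrib, ← Finset.mul_sum, hπ1, hm, expect]; ring
  have hh2 : expect π (fun x => h x ^ 2 * (H x - m)) =
      ∑ x, k x ^ 2 * (H x - m) * π x + 2 * a * Y := by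
    rw [← add_zero (_ + _), ← mul_zero (a ^ 2), ← hmean, hY, expect]
    simp only [Finset.mul_sum, ← Finset.sum_add_distrib]
    refine Finset.sum_congr rfl fun x _ => ?_
    have : h x = k x + a * s x := by simp only [hk]; ring
    rw [this]
    linear_combination (a ^ 2 * (H x - m) * π x) * hs2 x
  have hkD : -(D * κ) ≤ ∑ x, k x ^ 2 * (H x - m) * π x := by
    rw [hκ, ← neg_mul, Finset.mul_sum]
    refine Finset.sum_le_sum fun x _ => ?_
    have h1 := mul_nonneg (sq_nonneg (k x)) (hπ x)
    have h2 := hD x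
    have h3 : -D * (k x ^ 2 * π x) ≤ (H x - m) * (k x ^ 2 * π x) :=
      mul_le_mul_of_nonneg_right (by linarith) h1
    calc _ = -D * (k x ^ 2 * π x) := by simp only [hk]
      _ ≤ _ := h3
      _ = _ := by ring
  rw [hhH, hh2]
  -- `ε X` is split with weight `γ` and `a Y` with weight `1`, so that the growth rate is logistic
  have i1 : 2 * ε * X ≤ ε ^ 2 / (γ * b) + γ * b * X ^ 2 := by
    have hp : 0 < γ * b := by positivity
    have : ε ^ 2 / (γ * b) + γ * b * X ^ 2 - 2 * ε * X = (ε - γ * b * X) ^ 2 / (γ * b) := by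
      field_simp; ring
    have h2 : 0 ≤ (ε - γ * b * X) ^ 2 / (γ * b) := by positivity
    linarith
  have i2 : -(2 * a * Y) ≤ a ^ 2 / b + b * Y ^ 2 := by
    have : a ^ 2 / b + b * Y ^ 2 + 2 * a * Y = (a + b * Y) ^ 2 / b := by
      field_simp; ring
    have h2 : 0 ≤ (a + b * Y) ^ 2 / b := by positivity
    linarith
  have i3 : a ^ 2 / b ≤ ε / b := by
    rw [hεκ]; gcongr; linarith
  have i4 := mul_le_mul_of_nonneg_left hXV (by positivity : 0 ≤ γ * b)
  have i5 := mul_le_mul_of_nonneg_left hYV hb.le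
  linarith

end Static

namespace Hypercube

variable {N : ℕ}

theorem expect_curieWeissEnergy_nonpos (t : ℝ) :
    expect (curieWeissMeasure N t) (curieWeissEnergy N) ≤ 0 :=
  Finset.sum_nonpos fun σ _ =>
    mul_nonpos_of_nonpos_of_nonneg (curieWeissEnergy_nonpos σ) (curieWeissMeasure_pos t σ).le

/-- At low temperature the mean energy is close to the minimal energy `-N / 2`, by Jensen's
inequality for the exponential function. -/
theorem mul_expect_energy_add_half_le (hN : 0 < N) (t : ℝ) :
    t * (expect (curieWeissMeasure N t) (curieWeissEnergy N) + (N : ℝ) / 2) ≤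
      N * Real.log 2 := by
  set π := curieWeissMeasure N t with hπ
  set H := curieWeissEnergy N with hH
  have hN' : (N : ℝ) ≠ 0 := by exact_mod_cast hN.ne'
  have hπ1 : ∑ σ, π σ = 1 := sum_curieWeissMeasure t
  have hj := convexOn_exp.map_sum_le (t := Finset.univ) (w := π)
    (p := fun σ => t * (H σ + (N : ℝ) / 2)) (fun σ _ => (curieWeissMeasure_pos t σ).le) hπ1
    (fun _ _ => Set.mem_univ _)
  simp only [smul_eq_mul] at hj
  have e1 : ∑ σ, π σ * (t * (H σ + (N : ℝ) / 2)) = t * (expect π H + (N : ℝ) / 2) := by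
    have : ∑ σ, π σ * (t * (H σ + (N : ℝ) / 2)) =
        t * ∑ σ, H σ * π σ + t * ((N : ℝ) / 2) * ∑ σ, π σ := by
      simp only [Finset.mul_sum, ← Finset.sum_add_distrib]
      exact Finset.sum_congr rfl fun σ _ => by ring
    rw [this, hπ1, expect]; ring
  have hZ : Real.exp (t * ((N : ℝ) / 2)) ≤ ∑ τ : Hypercube N, spinWeight N t τ := by
    have h1 : spinWeight N t (1 : Hypercube N) = Real.exp (t * ((N : ℝ) / 2)) := by
      rw [spinWeight, (minusCount_eq_zero_iff 1).2 rfl]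
      congr 1; push_cast; field_simp; ring
    rw [← h1]
    exact Finset.single_le_sum (f := fun τ => spinWeight N t τ)
      (fun _ _ => (Real.exp_pos _).le) (Finset.mem_univ _)
  have hZ0 := (Real.exp_pos (t * ((N : ℝ) / 2))).trans_le hZ
  have e2 : ∑ σ, π σ * Real.exp (t * (H σ + (N : ℝ) / 2)) ≤ 2 ^ N := by
    have h1 : ∀ σ, π σ * Real.exp (t * (H σ + (N : ℝ) / 2)) ≤ 1 := by
      intro σ
      rw [hπ, curieWeissMeasure_eq, ← exp_neg_mul_curieWeissEnergy, mul_assoc, ← Real.exp_add,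
        show -t * curieWeissEnergy N σ + t * (H σ + (N : ℝ) / 2) = t * ((N : ℝ) / 2) by
          rw [hH]; ring, inv_mul_le_iff₀ hZ0, mul_one]
      exact hZ
    calc _ ≤ ∑ σ : Hypercube N, (1 : ℝ) := Finset.sum_le_sum fun σ _ => h1 σ
      _ = 2 ^ N := by simp [Fintype.card_units_int]
  rw [e1] at hj
  have h3 := Real.log_le_log (Real.exp_pos _) (hj.trans e2)
  rwa [Real.log_exp, Real.log_pow] at h3

theorem sum_sq_sub_expect_le (t c : ℝ) :
    ∑ σ, (curieWeissEnergy N σ - expect (curieWeissMeasure N t) (curieWeissEnergy N)) ^ 2 *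
        curieWeissMeasure N t σ ≤
      ∑ σ, (curieWeissEnergy N σ - c) ^ 2 * curieWeissMeasure N t σ := by
  set π := curieWeissMeasure N t with hπ
  set H := curieWeissEnergy N with hH
  have hπ1 : ∑ σ, π σ = 1 := sum_curieWeissMeasure t
  have e : ∀ c, ∑ σ, (H σ - c) ^ 2 * π σ =
      ∑ σ, H σ ^ 2 * π σ - 2 * c * expect π H + c ^ 2 := by
    intro c
    rw [← mul_one (c ^ 2), ← hπ1, expect]
    simp only [Finset.mul_sum, ← Finset.sum_sub_distrib, ← Finset.sum_add_distrib]
    exact Finset.sum_congr rfl fun σ _ => by ring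
  rw [e, e]
  nlinarith [sq_nonneg (c - expect π H)]

theorem variance_energy_le (t : ℝ) :
    ∑ σ, (curieWeissEnergy N σ - expect (curieWeissMeasure N t) (curieWeissEnergy N)) ^ 2 *
        curieWeissMeasure N t σ ≤ (N : ℝ) ^ 2 / 16 := by
  refine (sum_sq_sub_expect_le t (-((N : ℝ) / 4))).trans ?_
  calc _ ≤ ∑ σ : Hypercube N, (N : ℝ) ^ 2 / 16 * curieWeissMeasure N t σ := by
        refine Finset.sum_le_sum fun σ _ =>
          mul_le_mul_of_nonneg_right ?_ (curieWeissMeasure_pos t σ).le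
        nlinarith [curieWeissEnergy_nonpos σ, neg_half_le_curieWeissEnergy σ]
    _ = _ := by rw [← Finset.mul_sum, sum_curieWeissMeasure, mul_one]

theorem variance_energy_le_mul (t : ℝ) :
    ∑ σ, (curieWeissEnergy N σ - expect (curieWeissMeasure N t) (curieWeissEnergy N)) ^ 2 *
        curieWeissMeasure N t σ ≤
      (N : ℝ) / 2 * (expect (curieWeissMeasure N t) (curieWeissEnergy N) + (N : ℝ) / 2) := by
  refine (sum_sq_sub_expect_le t (-((N : ℝ) / 2))).trans ?_
  calc _ ≤ ∑ σ : Hypercube N, ((N : ℝ) / 2 * (curieWeissEnergy N σ * curieWeissMeasure N t σ) +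
          (N : ℝ) / 2 * ((N : ℝ) / 2) * curieWeissMeasure N t σ) := by
        refine Finset.sum_le_sum fun σ _ => ?_
        have h1 : (curieWeissEnergy N σ - -((N : ℝ) / 2)) ^ 2 ≤
            (N : ℝ) / 2 * (curieWeissEnergy N σ + (N : ℝ) / 2) := by
          nlinarith [curieWeissEnergy_nonpos σ, neg_half_le_curieWeissEnergy σ]
        have := mul_le_mul_of_nonneg_right h1 (curieWeissMeasure_pos t σ).le
        linarith
    _ = _ := by
        rw [Finset.sum_add_distrib, ← Finset.mul_sum, ← Finset.mul_sum, sum_curieWeissMeasure,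
          expect]
        ring

/-- The speed `9 / 4 * N ^ 3 + 9 / 8 * b * N ^ 4` outweighs the local Poincaré constant
`N ^ 2 * (1 + t)`: the factor `1 + t` is compensated since the energy concentrates as `t` grows. -/
theorem poincare_const_mul_le {t b : ℝ} (hN : 0 < N) (ht : 0 ≤ t) (hb : 0 < b) :
    ∃ V, ∑ σ, (curieWeissEnergy N σ - expect (curieWeissMeasure N t) (curieWeissEnergy N)) ^ 2 *
        curieWeissMeasure N t σ ≤ V ∧
      0 ≤ V ∧ (N : ℝ) ^ 2 * (1 + t) *
        ((expect (curieWeissMeasure N t) (curieWeissEnergy N) + (N : ℝ) / 2) +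
          (1 + Real.exp 1) * b * V) ≤ 2 * (9 / 4 * (N : ℝ) ^ 3 + 9 / 8 * b * (N : ℝ) ^ 4) := by
  set D := expect (curieWeissMeasure N t) (curieWeissEnergy N) + (N : ℝ) / 2 with hD
  have hN' : (1 : ℝ) ≤ N := by exact_mod_cast hN
  have he := Real.exp_one_lt_d9
  have hle : ∀ V, 0 ≤ V → (1 + t) * D ≤ 3 / 2 * N → (1 + t) * V ≤ 3 / 5 * (N : ℝ) ^ 2 →
      (N : ℝ) ^ 2 * (1 + t) * (D + (1 + Real.exp 1) * b * V) ≤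
        2 * (9 / 4 * (N : ℝ) ^ 3 + 9 / 8 * b * (N : ℝ) ^ 4) := by
    intro V hV h1 h2
    have h3 := mul_le_mul_of_nonneg_left h1 (by positivity : 0 ≤ (N : ℝ) ^ 2)
    have h4 := mul_le_mul_of_nonneg_left h2
      (by positivity : 0 ≤ (1 + Real.exp 1) * b * (N : ℝ) ^ 2)
    have h5 : (1 + Real.exp 1) * (b * (N : ℝ) ^ 4) ≤ 15 / 4 * (b * (N : ℝ) ^ 4) :=
      mul_le_mul_of_nonneg_right (by linarith) (by positivity)
    have h6 : 0 ≤ (N : ℝ) ^ 3 := by positivity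
    nlinarith
  have hDN : D ≤ N / 2 := by
    have := expect_curieWeissEnergy_nonpos (N := N) t
    rw [hD]; linarith
  rcases le_total t 2 with h | h
  -- at high temperature the crude bounds by the range of the energy suffice
  · refine ⟨N ^ 2 / 16, variance_energy_le t, by positivity, hle _ (by positivity) ?_ ?_⟩
    · nlinarith
    · nlinarith [sq_nonneg (N : ℝ)]
  · have hV := variance_energy_le_mul (N := N) t
    have hV0 : 0 ≤ (N : ℝ) / 2 * D := le_trans (Finset.sum_nonneg fun σ _ =>
      mul_nonneg (sq_nonneg _) (curieWeissMeasure_pos t σ).le) hV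
    have hD0 : 0 ≤ D := nonneg_of_mul_nonneg_right hV0 (by positivity)
    have htD : t * D ≤ N * Real.log 2 := mul_expect_energy_add_half_le hN t
    have hl := Real.log_two_lt_d9
    have htD' : t * D ≤ 7 / 10 * N := by nlinarith
    have h1 : (1 + t) * D ≤ 21 / 20 * N := by nlinarith
    refine ⟨N / 2 * D, hV, hV0, hle _ hV0 (by linarith) ?_⟩
    nlinarith

/-- The right-hand side of the evolution equation of the error `ε` is at most
`ε / b + ε ^ 2 / (e b)`, for every centred function `h` in place of `ν_t / μ_t - 1`. -/
theorem error_deriv_le {m : ℕ} (hN : N = 2 * m + 1) {t b M : ℝ} (ht : 0 ≤ t) (hb : 0 < b)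
    (hM : 9 / 4 * (N : ℝ) ^ 3 + 9 / 8 * b * (N : ℝ) ^ 4 ≤ M) {h : Hypercube N → ℝ}
    (h0 : ∑ σ, h σ * curieWeissMeasure N t σ = 0) :
    2 * expect (curieWeissMeasure N t) (fun σ => h σ ^ 2) *
        expect (curieWeissMeasure N t) (fun σ => h σ * curieWeissEnergy N σ)
      - expect (curieWeissMeasure N t) (fun σ => h σ ^ 2 *
        (curieWeissEnergy N σ - expect (curieWeissMeasure N t) (curieWeissEnergy N)))
      - 2 * M * dirichletForm (curieWeissMeasure N t) (curieWeissMetropolis N t) h ≤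
    expect (curieWeissMeasure N t) (fun σ => h σ ^ 2) / b +
      expect (curieWeissMeasure N t) (fun σ => h σ ^ 2) ^ 2 / (Real.exp 1 * b) := by
  have hN0 : 0 < N := by omega
  obtain ⟨V, hV, hV0, hC⟩ := poincare_const_mul_le hN0 ht hb
  have hπ0 : ∀ σ, 0 ≤ curieWeissMeasure N t σ := fun σ => (curieWeissMeasure_pos t σ).le
  have hpoin := sum_sub_sign_sq_le hN ht h0 rfl
  set D := expect (curieWeissMeasure N t) (curieWeissEnergy N) + (N : ℝ) / 2 with hD
  have hgrow := error_growth_le (s := magnetizationSign m) hπ0 (sum_curieWeissMeasure t)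
    (magnetizationSign_sq m)
    (sum_even_mul_magnetizationSign hN fun σ => by
      rw [curieWeissEnergy_neg, curieWeissMeasure_neg]) h0 rfl rfl hV
    (fun σ => by rw [hD]; linarith [neg_half_le_curieWeissEnergy σ] :
      ∀ σ, expect (curieWeissMeasure N t) (curieWeissEnergy N) - curieWeissEnergy N σ ≤ D)
    hb (Real.exp_pos 1)
  set E := dirichletForm (curieWeissMeasure N t) (curieWeissMetropolis N t) h
  set κ := ∑ σ, (h σ - (∑ σ, h σ * magnetizationSign m σ * curieWeissMeasure N t σ) *
    magnetizationSign m σ) ^ 2 * curieWeissMeasure N t σ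
  have hκ0 : 0 ≤ κ := Finset.sum_nonneg fun σ _ => mul_nonneg (sq_nonneg _) (hπ0 σ)
  have hC0 : 0 < (N : ℝ) ^ 2 * (1 + t) := by positivity
  have hE0 : 0 ≤ E := nonneg_of_mul_nonneg_right (hκ0.trans hpoin) hC0
  have hD0 : 0 ≤ D := by
    have : 0 ≤ (N : ℝ) / 2 * D := le_trans (Finset.sum_nonneg fun σ _ =>
      mul_nonneg (sq_nonneg _) (hπ0 σ)) (variance_energy_le_mul t)
    exact nonneg_of_mul_nonneg_right this (by positivity)
  have hG0 : 0 ≤ D + (1 + Real.exp 1) * b * V := by positivity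
  have h1 := mul_le_mul_of_nonneg_right hpoin hG0
  have h2 := mul_le_mul_of_nonneg_right hC hE0
  have h3 := mul_le_mul_of_nonneg_right hM hE0
  linarith

end Hypercube

/-! ### The logistic comparison and the flow -/

/-- The logistic comparison: `G = ε / (1 + ε / e)` satisfies `G' ≤ G / b`. -/
theorem le_exp_two_mul_of_logistic {ε ε' : ℝ → ℝ} {b : ℝ} (hb : 0 < b) (hε : ∀ t, 0 ≤ ε t)
    (hd : ∀ t ∈ Set.Icc 0 b, HasDerivWithinAt ε (ε' t) (Set.Ici 0) t)
    (hle : ∀ t ∈ Set.Icc 0 b, ε' t ≤ ε t / b + ε t ^ 2 / (Real.exp 1 * b)) (h0 : ε 0 ≤ 1)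
    {t : ℝ} (ht : t ∈ Set.Icc 0 b) : ε t ≤ Real.exp 2 * ε 0 := by
  set e := Real.exp 1 with he
  have he0 : 0 < e := Real.exp_pos 1
  have he1 : 1 < e := Real.one_lt_exp_iff.2 one_pos
  have hpos : ∀ t, 0 < 1 + ε t / e := fun t => by have := hε t; positivity
  have hG : ∀ t ∈ Set.Icc 0 b, HasDerivWithinAt (fun u => ε u / (1 + ε u / e))
      (ε' t / (1 + ε t / e) ^ 2) (Set.Ici 0) t := by
    intro t ht
    refine ((hd t ht).div (((hd t ht).div_const e).const_add 1) (hpos t).ne').congr_deriv ?_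
    congr 1
    field_simp
    ring
  have hG' : ∀ t ∈ Set.Icc 0 b, ε' t / (1 + ε t / e) ^ 2 ≤ 1 / b * (ε t / (1 + ε t / e)) := by
    intro t ht
    have hp := hpos t
    rw [div_le_iff₀ (by positivity)]
    refine (hle t ht).trans (le_of_eq ?_)
    field_simp
  have h := le_exp_mul_of_hasDerivWithinAt_le hG hG' ht
  have h1 : Real.exp (1 / b * t) ≤ e := by
    rw [he, Real.exp_le_exp, one_div_mul_eq_div, div_le_one hb]; exact ht.2
  have hε0 := hε 0
  have h2 : ε t / (1 + ε t / e) ≤ e * (ε 0 / (1 + ε 0 / e)) :=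
    h.trans (mul_le_mul_of_nonneg_right h1 (div_nonneg hε0 (hpos 0).le))
  have h3 : e * (ε 0 / (1 + ε 0 / e)) = e ^ 2 * ε 0 / (e + ε 0) := by field_simp
  rw [h3, div_le_div_iff₀ (hpos t) (by positivity)] at h2
  have h4 : e ^ 2 * ε 0 * (1 + ε t / e) = e ^ 2 * ε 0 + e * ε 0 * ε t := by field_simp
  rw [h4] at h2
  have h5 : Real.exp 2 = e ^ 2 := by rw [he, ← Real.exp_nat_mul]; norm_num
  rw [h5]
  have h6 : 0 ≤ (e - 1) * (1 - ε 0) * ε t :=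
    mul_nonneg (mul_nonneg (by linarith) (by linarith)) (hε t)
  nlinarith

section CurieWeissFlow

variable {N : ℕ} {M : ℝ → ℝ}

/-- The unnormalized flow `ν p_{0,t}` of the Curie–Weiss model. -/
noncomputable def curieWeissFlow (N : ℕ) (M : ℝ → ℝ) (ν : Hypercube N → ℝ) (t : ℝ) :
    Hypercube N → ℝ :=
  ν ᵥ* propagator (killedGenerator M (curieWeissMetropolis N) (curieWeissEnergy N)) 0 t

theorem curieWeissFlow_zero (hM : ContinuousOn M (Set.Ici 0)) (ν : Hypercube N → ℝ) :
    curieWeissFlow N M ν 0 = ν := by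
  rw [curieWeissFlow,
    (propagator_spec (curieWeiss_killedGenerator_continuousOn N M hM)).1, Matrix.vecMul_one]

theorem hasDerivWithinAt_curieWeissFlow (hM : ContinuousOn M (Set.Ici 0)) (ν : Hypercube N → ℝ)
    (t : ℝ) (ht : 0 ≤ t) (σ : Hypercube N) :
    HasDerivWithinAt (fun u => curieWeissFlow N M ν u σ) ((curieWeissFlow N M ν t ᵥ*
      killedGenerator M (curieWeissMetropolis N) (curieWeissEnergy N) t) σ) (Set.Ici 0) t := by
  have hp := propagator_spec (curieWeiss_killedGenerator_continuousOn N M hM)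
  have h := HasDerivWithinAt.fun_sum (u := Finset.univ) fun τ (_ : τ ∈ Finset.univ) =>
    (hp.2 t ht τ σ).const_mul (ν τ)
  rw [curieWeissFlow, Matrix.vecMul_vecMul]
  exact h

theorem curieWeissFlow_nonneg (hM : ContinuousOn M (Set.Ici 0)) (hM0 : ∀ t, 0 ≤ t → 0 ≤ M t)
    {ν : Hypercube N → ℝ} (hν : ∀ σ, 0 ≤ ν σ) {t : ℝ} (ht : 0 ≤ t) (σ : Hypercube N) :
    0 ≤ curieWeissFlow N M ν t σ := by
  refine nonneg_of_hasDerivWithinAt_vecMul (curieWeiss_killedGenerator_continuousOn N M hM)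
    (fun u hu x y hxy => ?_) (hasDerivWithinAt_curieWeissFlow hM ν)
    (by rw [curieWeissFlow_zero hM]; exact hν) ht σ
  rw [killedGenerator, Matrix.sub_apply, Matrix.diagonal_apply_ne _ hxy, sub_zero,
    Matrix.smul_apply, smul_eq_mul]
  exact mul_nonneg (hM0 u hu) (metropolis_nonneg_of_ne (Hypercube.curieWeissMeasure_pos u)
    Hypercube.nearestNeighborWalk_nonneg hxy)

/-- Since the energy is nonpositive, the total mass of the unnormalized flow does not decrease. -/
theorem one_le_sum_curieWeissFlow (hM : ContinuousOn M (Set.Ici 0))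
    (hM0 : ∀ t, 0 ≤ t → 0 ≤ M t) {ν : Hypercube N → ℝ}
    (hν : ν ∈ stdSimplex ℝ (Hypercube N)) {t : ℝ} (ht : 0 ≤ t) :
    1 ≤ ∑ σ, curieWeissFlow N M ν t σ := by
  have hd : ∀ u ∈ Set.Icc 0 t, HasDerivWithinAt (fun u => -∑ σ, curieWeissFlow N M ν u σ)
      (∑ σ, curieWeissEnergy N σ * curieWeissFlow N M ν u σ) (Set.Ici 0) u := by
    intro u hu
    have h := (HasDerivWithinAt.fun_sum (u := Finset.univ) fun σ (_ : σ ∈ Finset.univ) =>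
      hasDerivWithinAt_curieWeissFlow hM ν u hu.1 σ).neg
    rw [sum_vecMul_killedGenerator (sum_metropolis _ _), neg_neg] at h
    exact h
  have h := le_exp_mul_of_hasDerivWithinAt_le (c := 0) hd (fun u hu => by
    rw [zero_mul]
    exact Finset.sum_nonpos fun σ _ => mul_nonpos_of_nonpos_of_nonneg
      (Hypercube.curieWeissEnergy_nonpos σ) (curieWeissFlow_nonneg hM hM0 hν.1 hu.1 σ))
    ⟨ht, le_rfl⟩
  rw [curieWeissFlow_zero hM, hν.2] at h
  simpa using h

end CurieWeissFlow

theorem mainTheorem5 (N : ℕ) (hN : Odd N) (β : ℝ) (hβ : 0 < β)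
    (M : ℝ → ℝ) (hMcont : ContinuousOn M (Set.Ici 0)) (hMnonneg : ∀ t, 0 ≤ t → 0 ≤ M t)
    (hM : ∀ t ∈ Set.Ioo 0 β, 9 / 4 * (N : ℝ) ^ 3 + 9 / 8 * β * (N : ℝ) ^ 4 ≤ M t)
    (ν : Hypercube N → ℝ) (hν : ν ∈ stdSimplex ℝ (Hypercube N))
    (hε : curieWeissError N M ν 0 ≤ 1) :
    BddAbove (curieWeissError N M ν '' Set.Icc 0 β) ∧
      sSup (curieWeissError N M ν '' Set.Icc 0 β) ≤ Real.exp 2 * curieWeissError N M ν 0 := by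
  obtain ⟨m, hm⟩ := hN
  -- by continuity the lower bound for `M` holds up to the end points
  have hMcl : ∀ t ∈ Set.Icc 0 β, 9 / 4 * (N : ℝ) ^ 3 + 9 / 8 * β * (N : ℝ) ^ 4 ≤ M t := by
    intro t ht
    rw [← closure_Ioo hβ.ne] at ht
    refine le_on_closure hM continuousOn_const (hMcont.mono ?_) ht
    rw [closure_Ioo hβ.ne]
    exact Set.Icc_subset_Ici_self
  set q := curieWeissFlow N M ν with hq
  have hz : ∀ t ∈ Set.Icc 0 β, ∑ σ, q t σ ≠ 0 := fun t ht =>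
    (one_pos.trans_le (one_le_sum_curieWeissFlow hMcont hMnonneg hν ht.1)).ne'
  set h : ℝ → Hypercube N → ℝ := fun t σ =>
    ((∑ τ, q t τ)⁻¹ • q t) σ / curieWeissMeasure N t σ - 1 with hh
  have hcentred : ∀ t ∈ Set.Icc 0 β, ∑ σ, h t σ * curieWeissMeasure N t σ = 0 := by
    intro t ht
    have e : ∀ σ, h t σ * curieWeissMeasure N t σ =
        (∑ τ, q t τ)⁻¹ * q t σ - curieWeissMeasure N t σ := fun σ => by
      have := (Hypercube.curieWeissMeasure_pos t σ).ne'
      simp only [hh, Pi.smul_apply, smul_eq_mul]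
      field_simp
    simp only [e, Finset.sum_sub_distrib, ← Finset.mul_sum]
    rw [inv_mul_cancel₀ (hz t ht), Hypercube.sum_curieWeissMeasure, sub_self]
  have hbound : ∀ t ∈ Set.Icc 0 β,
      curieWeissError N M ν t ≤ Real.exp 2 * curieWeissError N M ν 0 := by
    intro t ht
    refine le_exp_two_mul_of_logistic hβ (fun t => ?_)
      (fun t ht => hasDerivWithinAt_meanSquareError (h := h t) Hypercube.uniformHypercube_pos
        (hasDerivWithinAt_curieWeissFlow hMcont ν t ht.1) (hz t ht)
        (metropolis_reversible (Hypercube.curieWeissMeasure_pos t)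
          Hypercube.nearestNeighborWalk_symm)
        (sum_metropolis _ _) fun σ => rfl)
      (fun t ht => Hypercube.error_deriv_le hm ht.1 hβ (hMcl t ht) (hcentred t ht)) hε ht
    exact Finset.sum_nonneg fun σ _ =>
      mul_nonneg (sq_nonneg _) (Hypercube.curieWeissMeasure_pos t σ).le
  refine ⟨⟨_, Set.forall_mem_image.2 hbound⟩, csSup_le ?_ (Set.forall_mem_image.2 hbound)⟩
  exact (Set.nonempty_Icc.2 hβ.le).image _
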